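/- Setting. Let $\mathcal X,\mathcal Y$ be finite sets, $\mathcal Z$ a set and $f\subseteq\mathcal X\times\mathcal Y\times\mathcal Z$ a relation. In a private-coin two-way protocol $\mathcal P$, Alice (input $x\in\mathcal X$) and Bob (input $y\in\mathcal Y$) each draw private coins, independently of each other and of the inputs; they then exchange messages, each depending on the sender's input, the sender's coins and the communication so far. Their complete transcript is denoted $M$. We say that $\mathcal P$ *computes $f$ with error $\epsilon$, with Bob (resp. Alice) answering*, if at the end Bob (resp. Alice) determines from the transcript and his (her) own input and coins an element $z$ such that, for every input $(x,y)$, $\Pr[(x,y,z)\notin f]\le\epsilon$. For inputs $(X,Y)$ drawn from a product distribution $\mu=\mu_X\times\mu_Y$ on $\mathcal X\times\mathcal Y$, let $I(X:M)$ and $I(Y:M)$ denote mutual information in bits. The privacy losses of $\mathcal P$ are $$L^{\mathcal P}(A,B)=\sup_{\mu\text{ product}} I(X:M),\qquad L^{\mathcal P}(B,A)=\sup_{\mu\text{ product}} I(Y:M).$$ Let $R^{1,A\to B,[\,]}_{\epsilon}(f)$ be the maximum, over all product distributions $\mu$ on $\mathcal X\times\mathcal Y$, of the least number $c$ for which there is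 a deterministic one-way protocol, with a single $c$-bit message from Alice to Bob after which Bob answers, whose average error for $f$ under $\mu$ is at most $\epsilon$. Define $R^{1,B\to A,[\,]}_{\epsilon}(f)$ in the same way with the roles of Alice and Bob exchanged. Theorem (classical privacy tradeoff). For all real $\epsilon,\epsilon'$ with $0<\epsilon\le\epsilon'<1/2$ there is a constant $C>0$, depending only on $\epsilon$ and $\epsilon'$, such that the following holds for all $\mathcal X,\mathcal Y,\mathcal Z$, every relation $f\subseteq\mathcal X\times\mathcal Y\times\mathcal Z$, where, if $\epsilon=\epsilon'$, it is assumed that $f$ is single-valued (for every $(x,y)$ at most one $z$ satisfies $(x,y,z)\in f$), and every private-coin two-way protocol $\mathcal P$: 1. if $\mathcal P$ computes $f$ with error $\epsilon$, with Bob answering, then $$L^{\mathcal P}(A,B)\cdot 2^{C\,(L^{\mathcal P}(B,A)+1)}\;\ge\;R^{1,A\to B,[\,]}_{\epsilon'}(f);$$ 2. if $\mathcal P$ computes $f$ with error $\epsilon$, with Alice answering, then $$L^{\mathcal P}(B,A)\cdot 2^{C\,(L^{\mathcal P}(A,B)+1)}\;\ge\;R^{1,B\to A,[\,]}_{\epsilon'}(f).$$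 -/

import Mathlib

open scoped ENNReal

namespace PrivacyTradeoff

/-! ### Entropy and mutual information (in bits) of finite random variables -/

/-- Shannon entropy, in bits, of a distribution on a finite set. -/
noncomputable def entropy {α : Type*} [Fintype α] (p : PMF α) : ℝ :=
  (∑ a, Real.negMulLog (p a).toReal) / Real.log 2

/-- Mutual information `I(U : V) = H(U) + H(V) - H(UV)` of a pair with joint law `p`. -/
noncomputable def mutualInfo {α β : Type*} [Fintype α] [Fintype β] (p : PMF (α × β)) : ℝ :=
  entropy (p.map Prod.fst) + entropy (p.map Prod.snd) - entropy p

/-! ### Two-way protocols -/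

/-- A deterministic two-way protocol tree; Alice's data lie in `A` and Bob's in `B`. At an inner
node its owner sends one bit, a function of the owner's data (and, through the node, of the
communication so far), and the run moves to the corresponding child. -/
inductive ProtocolTree (A B : Type*) where
  | leaf : ProtocolTree A B
  | alice (send : A → Bool) (next : Bool → ProtocolTree A B) : ProtocolTree A B
  | bob (send : B → Bool) (next : Bool → ProtocolTree A B) : ProtocolTree A B

namespace ProtocolTree

variable {A B : Type*}

/-- The complete transcripts of a protocol tree (its root-to-leaf paths). -/
def Transcript : ProtocolTree A B → Type
  | leaf => Unit
  | alice _ next => Σ b : Bool, Transcript (next b)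
  | bob _ next => Σ b : Bool, Transcript (next b)

/-- A protocol tree has finitely many transcripts. -/
instance instFintypeTranscript : (t : ProtocolTree A B) → Fintype t.Transcript
  | leaf => inferInstanceAs (Fintype Unit)
  | alice _ next =>
      haveI := fun b => instFintypeTranscript (next b)
      inferInstanceAs (Fintype (Σ b : Bool, Transcript (next b)))
  | bob _ next =>
      haveI := fun b => instFintypeTranscript (next b)
      inferInstanceAs (Fintype (Σ b : Bool, Transcript (next b)))

/-- The transcript produced when Alice holds `a` and Bob holds `b`. -/
def run : (t : ProtocolTree A B) → A → B → t.Transcript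
  | leaf, _, _ => ()
  | alice send next, a, b => ⟨send a, run (next (send a)) a b⟩
  | bob send next, a, b => ⟨send b, run (next (send b)) a b⟩

end ProtocolTree

/-- The communication part of a private-coin two-way protocol: Alice, with input in `X`, draws
private coins from `coinsA`; Bob, with input in `Y`, independently draws private coins from
`coinsB`; then they follow a deterministic protocol tree, each using the own input and the own
coins only. -/
structure Protocol (X Y RA RB : Type*) where
  coinsA : PMF RA
  coinsB : PMF RB
  tree : ProtocolTree (X × RA) (Y × RB)

namespace Protocol

variable {X Y Z RA RB : Type*}

/-- The joint law of Alice's coins and Bob's coins. -/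
noncomputable def coins (P : Protocol X Y RA RB) : PMF (RA × RB) :=
  P.coinsA.bind fun rA => P.coinsB.map fun rB => (rA, rB)

/-- The law of the complete transcript on the inputs `x`, `y`. -/
noncomputable def transcriptLaw (P : Protocol X Y RA RB) (x : X) (y : Y) :
    PMF P.tree.Transcript :=
  P.coins.map fun r => P.tree.run (x, r.1) (y, r.2)

/-- The law of the pair `(X, M)` of Alice's input and the transcript, for inputs drawn from the
product distribution `μX × μY`. -/
noncomputable def lawXM (P : Protocol X Y RA RB) (μX : PMF X) (μY : PMF Y) :
    PMF (X × P.tree.Transcript) :=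
  μX.bind fun x => μY.bind fun y => (P.transcriptLaw x y).map fun m => (x, m)

/-- The law of the pair `(Y, M)` of Bob's input and the transcript, for inputs drawn from the
product distribution `μX × μY`. -/
noncomputable def lawYM (P : Protocol X Y RA RB) (μX : PMF X) (μY : PMF Y) :
    PMF (Y × P.tree.Transcript) :=
  μX.bind fun x => μY.bind fun y => (P.transcriptLaw x y).map fun m => (y, m)

/-- Privacy loss from Alice to Bob: the supremum of `I(X : M)` over product distributions. -/
noncomputable def privacyLossAB [Fintype X] (P : Protocol X Y RA RB) : ℝ :=
  ⨆ μ : PMF X × PMF Y, mutualInfo (P.lawXM μ.1 μ.2)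

/-- Privacy loss from Bob to Alice: the supremum of `I(Y : M)` over product distributions. -/
noncomputable def privacyLossBA [Fintype Y] (P : Protocol X Y RA RB) : ℝ :=
  ⨆ μ : PMF X × PMF Y, mutualInfo (P.lawYM μ.1 μ.2)

/-- `P`, with Bob computing the answer from the transcript, his input and his coins by the rule
`out`, computes the relation `f` with error at most `ε` on every input. -/
def BobComputes (P : Protocol X Y RA RB) (out : P.tree.Transcript → Y × RB → Z)
    (f : X → Y → Z → Prop) (ε : ℝ) : Prop :=
  ∀ x y, P.coins.toOuterMeasure
    {r | ¬ f x y (out (P.tree.run (x, r.1) (y, r.2)) (y, r.2))} ≤ ENNReal.ofReal ε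

/-- `P`, with Alice computing the answer from the transcript, her input and her coins by the rule
`out`, computes the relation `f` with error at most `ε` on every input. -/
def AliceComputes (P : Protocol X Y RA RB) (out : P.tree.Transcript → X × RA → Z)
    (f : X → Y → Z → Prop) (ε : ℝ) : Prop :=
  ∀ x y, P.coins.toOuterMeasure
    {r | ¬ f x y (out (P.tree.run (x, r.1) (y, r.2)) (x, r.1))} ≤ ENNReal.ofReal ε

end Protocol

/-! ### One-way distributional complexity -/

/-- The product distribution `μX × μY`. -/
noncomputable def prodLaw {X Y : Type*} (μX : PMF X) (μY : PMF Y) : PMF (X × Y) :=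
  μX.bind fun x => μY.map fun y => (x, y)

/-- There is a deterministic one-way protocol for `f` in which the holder of the `X`-input sends
`c` bits, the holder of the `Y`-input then answers, and the average error under `μ` is at most
`ε`. -/
def HasOneWayProtocol {X Y Z : Type*} (f : X → Y → Z → Prop) (ε : ℝ) (μ : PMF (X × Y))
    (c : ℕ) : Prop :=
  ∃ (msg : X → (Fin c → Bool)) (out : (Fin c → Bool) → Y → Z),
    μ.toOuterMeasure {p | ¬ f p.1 p.2 (out (msg p.1) p.2)} ≤ ENNReal.ofReal ε

/-- One-way (message sent by the holder of the `X`-input) distributional communication complexity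
of `f` under `μ` with average error at most `ε`; it is `⊤` if there is no such protocol. -/
noncomputable def oneWayComplexity {X Y Z : Type*} (f : X → Y → Z → Prop) (ε : ℝ)
    (μ : PMF (X × Y)) : ℕ∞ :=
  ⨅ (c : ℕ) (_ : HasOneWayProtocol f ε μ c), (c : ℕ∞)

/-- The maximum over product distributions of the one-way distributional complexity of `f` with
average error at most `ε`, where Alice sends the message. -/
noncomputable def oneWayProductAB {X Y Z : Type*} (f : X → Y → Z → Prop) (ε : ℝ) : ℕ∞ :=
  ⨆ (μX : PMF X) (μY : PMF Y), oneWayComplexity f ε (prodLaw μX μY)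

/-- The same with Bob sending the message. -/
noncomputable def oneWayProductBA {X Y Z : Type*} (f : X → Y → Z → Prop) (ε : ℝ) : ℕ∞ :=
  oneWayProductAB (fun y x z => f x y z) ε

/-- `f` is single-valued, i.e. at most one answer is correct on each input. -/
def SingleValued {X Y Z : Type*} (f : X → Y → Z → Prop) : Prop :=
  ∀ x y z z', f x y z → f x y z' → z = z'

/-! ### The suprema that define the privacy losses are suprema of bounded sets -/

lemma entropy_nonneg {α : Type*} [Fintype α] (p : PMF α) : 0 ≤ entropy p := by
  refine div_nonneg (Finset.sum_nonneg fun a _ => Real.negMulLog_nonneg ENNReal.toReal_nonneg ?_)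
    (Real.log_nonneg one_le_two)
  exact ENNReal.toReal_le_of_le_ofReal zero_le_one (by simpa using p.coe_le_one a)

lemma entropy_le {α : Type*} [Fintype α] (p : PMF α) :
    entropy p ≤ Fintype.card α / Real.log 2 := by
  have h : ∀ a ∈ Finset.univ, Real.negMulLog (p a).toReal ≤ 1 := fun a _ => by
    have h0 : 0 ≤ (p a).toReal := ENNReal.toReal_nonneg
    rcases h0.eq_or_lt with h | h
    · simp [← h]
    · have := Real.one_sub_inv_le_log_of_pos h
      have h2 : (p a).toReal * (p a).toReal⁻¹ = 1 := mul_inv_cancel₀ h.ne'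
      rw [Real.negMulLog]
      nlinarith
  have := Finset.sum_le_card_nsmul _ _ _ h
  refine div_le_div_of_nonneg_right ?_ (Real.log_nonneg one_le_two)
  simpa using this

lemma mutualInfo_le {α β : Type*} [Fintype α] [Fintype β] (p : PMF (α × β)) :
    mutualInfo p ≤ (Fintype.card α + Fintype.card β) / Real.log 2 := by
  have h1 := entropy_le (p.map Prod.fst)
  have h2 := entropy_le (p.map Prod.snd)
  have h3 := entropy_nonneg p
  rw [mutualInfo, add_div]
  linarith

lemma bddAbove_privacyLossAB {X Y RA RB : Type*} [Fintype X] (P : Protocol X Y RA RB) :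
    BddAbove (Set.range fun μ : PMF X × PMF Y => mutualInfo (P.lawXM μ.1 μ.2)) :=
  ⟨_, by rintro _ ⟨μ, rfl⟩; exact mutualInfo_le _⟩

lemma bddAbove_privacyLossBA {X Y RA RB : Type*} [Fintype Y] (P : Protocol X Y RA RB) :
    BddAbove (Set.range fun μ : PMF X × PMF Y => mutualInfo (P.lawYM μ.1 μ.2)) :=
  ⟨_, by rintro _ ⟨μ, rfl⟩; exact mutualInfo_le _⟩

end PrivacyTradeoff

set_option linter.unusedSectionVars false

namespace PrivacyTradeoff

section Estimates

/-! ### Relative entropy estimates (in nats) -/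

/-! The transcript has rectangle structure: its probability on `x`, `y` is a factor `α x m` of Alice
times a factor `β y m` of Bob (`ProtocolTree.run_eq_iff`, `modelOf`). Alice can therefore sample a
transcript from its law given `x` alone, `α x m * βbar m`, and Bob can correct it to the law on `x`,
`y` by importance sampling with the ratio `β y m / βbar m`. This ratio is also that of the law of
the transcript given `y` to its average law, so when the transcript carries at most `B` nats about
Bob's input, the ratio rarely exceeds some `K = exp(O(B + 1))` (`sum_bad_le`). After truncation at
`K` the weights have second moment at most `K`, and Chebyshev shows that `N = exp(O(B + 1))`
independent samples suffice for Bob (`exists_decision`). If correct answers are unique, he takes a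
weighted majority vote, which pushes the error below `ε`; otherwise he minimizes his expected error,
which costs a little more than `ε` and needs `ε < ε'`. Either way some slack below `ε'` remains.

The `N` samples are then compressed. Their relative entropy to `N` samples of the average law is `N`
times the information about `x` (`relEntropy_iid`). If that information is at most `A`, a random
codebook with `exp(O(N * A + 1))` words contains a word good enough for most inputs, which takes
`O(N * A + 1)` bits (`exists_code_of_relEntropy_le`). When `N * A` is tiny, Pinsker's inequality
shows that a fixed message does as well (`exists_constant_of_relEntropy_le`), so the additive
constant disappears and `A * exp(O(B + 1))` bits remain. The case in which Alice answers is the same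
argument with the parties exchanged. -/

lemma sq_sqrt_sub_sqrt_le {p q : ℝ} (hp : 0 ≤ p) (hq : 0 ≤ q) (hpq : q = 0 → p = 0) :
    (√p - √q) ^ 2 ≤ p * Real.log (p / q) - p + q := by
  rcases hp.eq_or_lt with rfl | hp'
  · simp [Real.sq_sqrt hq]
  have hq' : 0 < q := hq.lt_of_ne fun h => hp'.ne' (hpq h.symm)
  have hsp : 0 < √p := Real.sqrt_pos.2 hp'
  have hsq : 0 < √q := Real.sqrt_pos.2 hq'
  have h1 : Real.log (p / q) = -(2 * Real.log (√q / √p)) := by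
    rw [Real.log_div hp'.ne' hq'.ne', Real.log_div hsq.ne' hsp.ne', Real.log_sqrt hp, Real.log_sqrt hq]
    ring
  -- The whole inequality is `log t ≤ t - 1` at `t = √q / √p`, multiplied by `2 * p`.
  have h2 := Real.log_le_sub_one_of_pos (div_pos hsq hsp)
  have h3 : p * (√q / √p) = √p * √q := by
    field_simp
    rw [Real.sq_sqrt hp]
  have h4 := mul_le_mul_of_nonneg_left h2 hp
  rw [h1, sub_sq, Real.sq_sqrt hp, Real.sq_sqrt hq]
  nlinarith

variable {ι : Type*} [Fintype ι]

/-- The relative entropy, in nats, of two nonnegative functions on a finite set. -/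
noncomputable def relEntropy (p q : ι → ℝ) : ℝ := ∑ i, p i * Real.log (p i / q i)

lemma sum_sq_sqrt_sub_sqrt_le {p q : ι → ℝ} (hp : ∀ i, 0 ≤ p i) (hq : ∀ i, 0 ≤ q i)
    (hpq : ∀ i, q i = 0 → p i = 0) (hs : ∑ i, p i = ∑ i, q i) :
    ∑ i, (√(p i) - √(q i)) ^ 2 ≤ relEntropy p q := by
  have := Finset.sum_le_sum fun i (_ : i ∈ Finset.univ) =>
    sq_sqrt_sub_sqrt_le (hp i) (hq i) (hpq i)
  rw [Finset.sum_add_distrib, Finset.sum_sub_distrib] at this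
  rw [relEntropy]
  linarith

lemma relEntropy_nonneg {p q : ι → ℝ} (hp : ∀ i, 0 ≤ p i) (hq : ∀ i, 0 ≤ q i)
    (hpq : ∀ i, q i = 0 → p i = 0) (hs : ∑ i, p i = ∑ i, q i) : 0 ≤ relEntropy p q :=
  (Finset.sum_nonneg fun _ _ => sq_nonneg _).trans (sum_sq_sqrt_sub_sqrt_le hp hq hpq hs)

/-- The classical substate property: `p` gives little mass to a set on which it exceeds `K q`. -/
lemma sum_mul_log_sub_one_le {p q : ι → ℝ} (hp : ∀ i, 0 ≤ p i) (hq : ∀ i, 0 ≤ q i)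
    (hpq : ∀ i, q i = 0 → p i = 0) (hs : ∑ i, p i = ∑ i, q i) {K : ℝ} (hK : 0 < K)
    (S : Finset ι) (hS : ∀ i ∈ S, K * q i ≤ p i) :
    (∑ i ∈ S, p i) * (Real.log K - 1) ≤ relEntropy p q := by
  have h1 : ∀ i, 0 ≤ p i * Real.log (p i / q i) - p i + q i := fun i =>
    (sq_nonneg _).trans (sq_sqrt_sub_sqrt_le (hp i) (hq i) (hpq i))
  -- Adding `q - p` makes every summand nonnegative without changing the total, so the sum may be
  -- restricted to `S`; this costs the `-1`.
  have h2 : ∀ i ∈ S, p i * (Real.log K - 1) ≤ p i * Real.log (p i / q i) - p i + q i := by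
    intro i hi
    rcases (hp i).eq_or_lt with h | h
    · simp [← h, hq i]
    have hq' : 0 < q i := (hq i).lt_of_ne fun h' => h.ne' (hpq i h'.symm)
    have h3 : Real.log K ≤ Real.log (p i / q i) :=
      Real.log_le_log hK ((le_div_iff₀ hq').2 (hS i hi))
    nlinarith
  have h3 := Finset.sum_le_sum h2
  have h4 := Finset.sum_le_sum_of_subset_of_nonneg (Finset.subset_univ S) fun i _ _ => h1 i
  rw [← Finset.sum_mul] at h3
  rw [Finset.sum_add_distrib (s := Finset.univ), Finset.sum_sub_distrib] at h4
  rw [relEntropy]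
  linarith

/-- A form of Pinsker's inequality. -/
lemma sum_mul_le_add_relEntropy {p q : ι → ℝ} (hp : ∀ i, 0 ≤ p i) (hq : ∀ i, 0 ≤ q i)
    (hpq : ∀ i, q i = 0 → p i = 0) (hp1 : ∑ i, p i = 1) (hq1 : ∑ i, q i = 1) {s : ℝ} (hs : 0 < s)
    (h : ι → ℝ) (h0 : ∀ i, 0 ≤ h i) (h1 : ∀ i, h i ≤ 1) :
    ∑ i, q i * h i ≤ ∑ i, p i * h i + relEntropy p q / (2 * s) + 2 * s := by
  -- Factor `q - p = (√q - √p) * (√q + √p)` and apply the arithmetic-geometric mean inequality with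
  -- parameter `s`; the first square sums to at most the relative entropy.
  have key : ∀ i, q i * h i ≤ p i * h i + (√(p i) - √(q i)) ^ 2 / (2 * s) + s * (p i + q i) := by
    intro i
    have hsp := Real.sqrt_nonneg (p i)
    have hsq := Real.sqrt_nonneg (q i)
    have e1 : (√(q i) - √(p i)) * (√(q i) + √(p i)) = q i - p i := by
      nlinarith [Real.sq_sqrt (hp i), Real.sq_sqrt (hq i)]
    have e2 : (√(q i) - √(p i)) * (√(q i) + √(p i)) ≤
        (√(p i) - √(q i)) ^ 2 / (2 * s) + s * (p i + q i) := by
      have e3 : (√(q i) + √(p i)) ^ 2 ≤ 2 * (p i + q i) := by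
        nlinarith [Real.sq_sqrt (hp i), Real.sq_sqrt (hq i), sq_nonneg (√(p i) - √(q i))]
      rw [div_add' _ _ _ (by positivity), le_div_iff₀ (by positivity)]
      nlinarith [sq_nonneg ((√(q i) - √(p i)) - s * (√(q i) + √(p i))), mul_le_mul_of_nonneg_left e3 (sq_nonneg s)]
    have e4 : 0 ≤ (√(p i) - √(q i)) ^ 2 / (2 * s) + s * (p i + q i) := by
      have := hp i; have := hq i; positivity
    nlinarith [h0 i, h1 i]
  refine (Finset.sum_le_sum fun i _ => key i).trans ?_
  rw [Finset.sum_add_distrib, Finset.sum_add_distrib, ← Finset.sum_div, ← Finset.mul_sum,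
    Finset.sum_add_distrib, hp1, hq1]
  have := div_le_div_of_nonneg_right
    (sum_sq_sqrt_sub_sqrt_le hp hq hpq (hp1.trans hq1.symm)) (by positivity : 0 ≤ 2 * s)
  linarith

/-! ### Independent samples -/

variable {M : Type*} [Fintype M]

lemma sum_prod_mul_prod (κ : Type*) [Fintype κ] [DecidableEq κ] (p g : M → ℝ) :
    ∑ w : κ → M, (∏ i, p (w i)) * ∏ i, g (w i) = (∑ m, p m * g m) ^ Fintype.card κ := by
  simp_rw [← Finset.prod_mul_distrib]
  rw [← Finset.card_univ, ← Finset.prod_const, Finset.prod_univ_sum, Fintype.piFinset_univ]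

lemma sum_prod_eq_one (κ : Type*) [Fintype κ] [DecidableEq κ] {p : M → ℝ} (hp1 : ∑ m, p m = 1) :
    ∑ w : κ → M, ∏ i, p (w i) = 1 := by
  simpa [hp1] using sum_prod_mul_prod κ p 1

lemma sum_fin_succ_fun {N : ℕ} (F : (Fin (N + 1) → M) → ℝ) :
    ∑ w, F w = ∑ m, ∑ w, F (Fin.cons m w) := by
  rw [← (Fin.consEquiv fun _ => M).sum_comp, Fintype.sum_prod_type]
  rfl

lemma sum_prod_mul_sum {p : M → ℝ} (hp1 : ∑ m, p m = 1) (g : M → ℝ) (N : ℕ) :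
    ∑ w : Fin N → M, (∏ i, p (w i)) * ∑ i, g (w i) = N * ∑ m, p m * g m := by
  induction N with
  | zero => simp
  | succ N ih =>
    rw [sum_fin_succ_fun]
    simp only [Fin.prod_univ_succ, Fin.sum_univ_succ, Fin.cons_zero, Fin.cons_succ]
    have h : ∀ m, ∑ w : Fin N → M, (p m * ∏ i, p (w i)) * (g m + ∑ i, g (w i)) =
        p m * g m + p m * (N * ∑ m, p m * g m) := by
      intro m
      rw [← ih]
      simp_rw [mul_add, Finset.sum_add_distrib, mul_assoc, ← Finset.mul_sum]
      rw [← Finset.sum_mul, sum_prod_eq_one (Fin N) hp1, one_mul]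
    simp_rw [h, Finset.sum_add_distrib, ← Finset.sum_mul, hp1]
    push_cast
    ring

/-- Since `g` has mean zero, the cross terms between independent samples vanish and variances add.
-/
lemma sum_prod_mul_sum_sq {p : M → ℝ} (hp1 : ∑ m, p m = 1) (g : M → ℝ)
    (hg : ∑ m, p m * g m = 0) (N : ℕ) :
    ∑ w : Fin N → M, (∏ i, p (w i)) * (∑ i, g (w i)) ^ 2 = N * ∑ m, p m * g m ^ 2 := by
  induction N with
  | zero => simp
  | succ N ih =>
    rw [sum_fin_succ_fun]
    simp only [Fin.prod_univ_succ, Fin.sum_univ_succ, Fin.cons_zero, Fin.cons_succ]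
    have h : ∀ m, ∑ w : Fin N → M, (p m * ∏ i, p (w i)) * (g m + ∑ i, g (w i)) ^ 2 =
        p m * g m ^ 2 + p m * (N * ∑ m, p m * g m ^ 2) := by
      intro m
      have h2 := sum_prod_mul_sum hp1 g N
      rw [hg, mul_zero] at h2
      have h3 : ∀ w : Fin N → M, (p m * ∏ i, p (w i)) * (g m + ∑ i, g (w i)) ^ 2 =
          p m * g m ^ 2 * (∏ i, p (w i)) + 2 * p m * g m * ((∏ i, p (w i)) * ∑ i, g (w i)) +
          p m * ((∏ i, p (w i)) * (∑ i, g (w i)) ^ 2) := fun w => by ring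
      simp_rw [h3, Finset.sum_add_distrib, ← Finset.mul_sum]
      rw [h2, ih, sum_prod_eq_one (Fin N) hp1]
      ring
    simp_rw [h, Finset.sum_add_distrib, ← Finset.sum_mul, hp1]
    push_cast
    ring

open Classical in
/-- Chebyshev's inequality for a sum of independent samples. -/
lemma sum_prod_indicator_le {p : M → ℝ} (hp : ∀ m, 0 ≤ p m) (hp1 : ∑ m, p m = 1) (g : M → ℝ)
    {K t s : ℝ} (hs : 0 < s) (hK : ∑ m, p m * g m ^ 2 ≤ K) (ht : t + s ≤ ∑ m, p m * g m)
    {N : ℕ} (hN : 0 < N) :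
    ∑ w : Fin N → M, (∏ i, p (w i)) * (if ∑ i, g (w i) ≤ N * t then 1 else 0) ≤
      K / (N * s ^ 2) := by
  set μ := ∑ m, p m * g m with hμ
  have hN' : (0 : ℝ) < N := by exact_mod_cast hN
  have h0 : ∑ m, p m * (g m - μ) = 0 := by
    simp_rw [mul_sub, Finset.sum_sub_distrib, ← Finset.sum_mul, hp1, one_mul, ← hμ, sub_self]
  have h1 := sum_prod_mul_sum_sq hp1 (fun m => g m - μ) h0 N
  have h2 : ∑ m, p m * (g m - μ) ^ 2 ≤ K := by
    have h3 : ∀ m, p m * (g m - μ) ^ 2 = p m * g m ^ 2 - 2 * μ * (p m * g m) + μ ^ 2 * p m :=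
      fun m => by ring
    simp_rw [h3, Finset.sum_add_distrib, Finset.sum_sub_distrib, ← Finset.mul_sum, hp1, ← hμ]
    nlinarith [sq_nonneg μ]
  have h4 : ∀ w : Fin N → M, (∏ i, p (w i)) * (if ∑ i, g (w i) ≤ N * t then 1 else 0) ≤
      (∏ i, p (w i)) * (∑ i, (g (w i) - μ)) ^ 2 / (N * s) ^ 2 := by
    intro w
    have hw : 0 ≤ ∏ i, p (w i) := Finset.prod_nonneg fun i _ => hp _
    rw [mul_div_assoc]
    refine mul_le_mul_of_nonneg_left ?_ hw
    split_ifs with h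
    · rw [one_le_div (by positivity)]
      have h5 : ∑ i, (g (w i) - μ) = ∑ i, g (w i) - N * μ := by
        simp [Finset.sum_sub_distrib]
      have h6 : N * s ≤ -∑ i, (g (w i) - μ) := by
        rw [h5]
        nlinarith
      rw [← neg_sq (∑ i, (g (w i) - μ))]
      exact pow_le_pow_left₀ (by positivity) h6 2
    · positivity
  refine (Finset.sum_le_sum fun w _ => h4 w).trans ?_
  rw [← Finset.sum_div, h1, mul_pow, div_le_div_iff₀ (by positivity) (by positivity)]
  have := mul_le_mul_of_nonneg_left h2 (by positivity : 0 ≤ N * (N * s ^ 2))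
  nlinarith

/-- On words of nonzero `p`-weight the logarithm of the product ratio is a sum of one-letter terms,
each with mean `relEntropy p q`. -/
lemma relEntropy_iid {p q : M → ℝ} (hp1 : ∑ m, p m = 1)
    (hpq : ∀ m, q m = 0 → p m = 0) (N : ℕ) :
    relEntropy (fun w : Fin N → M => ∏ i, p (w i)) (fun w => ∏ i, q (w i)) =
      N * relEntropy p q := by
  rw [relEntropy, relEntropy, ← sum_prod_mul_sum hp1]
  refine Finset.sum_congr rfl fun w _ => ?_
  by_cases h : ∏ i, p (w i) = 0
  · simp [h]
  have h1 : ∀ i, p (w i) ≠ 0 := fun i => Finset.prod_ne_zero_iff.1 h i (Finset.mem_univ i)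
  rw [← Finset.prod_div_distrib, Real.log_prod fun i _ =>
    div_ne_zero (h1 i) fun h' => h1 i (hpq _ h')]

end Estimates

/-! ### One-way message compression -/

open Classical in
/-- A random codebook contains a codeword of small cost, if small cost is not too unlikely. -/
lemma sum_codebook_min_le {W κ : Type*} [Fintype W] [Fintype κ] {R : W → ℝ}
    (hR : ∀ w, 0 ≤ R w) (hR1 : ∑ w, R w = 1) {h : W → ℝ}
    (h1 : ∀ w, h w ≤ 1) {t g n : ℝ} (ht : 0 ≤ t) (hg : g ≤ ∑ w, R w * (if h w ≤ t then 1 else 0))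
    (hn : n ≤ Fintype.card κ) (hgn : 0 < g * n) (hn0 : 0 ≤ n) (H : (κ → W) → ℝ)
    (hH : ∀ code i, H code ≤ h (code i)) :
    ∑ code : κ → W, (∏ i, R (code i)) * H code ≤ t + 1 / (g * n) := by
  have hg0 : 0 < g := pos_of_mul_pos_left hgn hn0
  have hn1 : 0 < n := pos_of_mul_pos_right hgn hg0.le
  have hκ : Nonempty κ := by
    by_contra hne
    rw [not_nonempty_iff] at hne
    simp at hn
    linarith
  set F : W → ℝ := fun w => if h w ≤ t then 0 else 1 with hF
  -- The product is the indicator that every codeword is costly; independence turns its mean into a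
  -- power.
  have key : ∀ code : κ → W, H code ≤ t + ∏ i, F (code i) := by
    intro code
    by_cases hc : ∃ i, h (code i) ≤ t
    · obtain ⟨i, hi⟩ := hc
      have : ∏ i, F (code i) = 0 := Finset.prod_eq_zero (Finset.mem_univ i) (by simp [hF, hi])
      rw [this, add_zero]
      exact (hH code i).trans hi
    · push Not at hc
      have : ∏ i, F (code i) = 1 := Finset.prod_eq_one fun i _ => by simp [hF, hc i]
      rw [this]
      have := (hH code hκ.some).trans (h1 _)
      linarith
  have h2 : ∑ w, R w * F w ≤ 1 - g := by
    have : ∀ w, R w * F w = R w - R w * (if h w ≤ t then 1 else 0) := fun w => by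
      simp only [hF]; split_ifs <;> ring
    simp_rw [this, Finset.sum_sub_distrib, hR1]
    linarith
  have h3 : 0 ≤ ∑ w, R w * F w := Finset.sum_nonneg fun w _ =>
    mul_nonneg (hR w) (by simp only [hF]; split_ifs <;> norm_num)
  calc ∑ code : κ → W, (∏ i, R (code i)) * H code
      ≤ ∑ code : κ → W, (∏ i, R (code i)) * (t + ∏ i, F (code i)) :=
        Finset.sum_le_sum fun code _ => mul_le_mul_of_nonneg_left (key code)
          (Finset.prod_nonneg fun i _ => hR _)
    _ = t + (∑ w, R w * F w) ^ Fintype.card κ := by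
        simp_rw [mul_add, Finset.sum_add_distrib]
        rw [← Finset.sum_mul, sum_prod_eq_one κ hR1, sum_prod_mul_prod, one_mul]
    _ ≤ t + 1 / (g * n) := by
        gcongr
        -- The crude bound `(1 - g) ^ k ≤ exp (-g * k) ≤ 1 / (g * n)` for `k = Fintype.card κ` is
        -- enough, because the codebook size later enters only through its logarithm.
        have h4 : ∑ w, R w * F w ≤ Real.exp (-g) := h2.trans (by
          have := Real.add_one_le_exp (-g); linarith)
        refine (pow_le_pow_left₀ h3 h4 _).trans ?_
        rw [← Real.exp_nat_mul, mul_neg, Real.exp_neg, one_div]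
        refine inv_anti₀ hgn ?_
        have h5 := Real.add_one_le_exp ((Fintype.card κ : ℝ) * g)
        nlinarith

open Classical in
/-- Compression of a one-way message: a message `w` with law `Q x` on input `x`, whose relative
entropy to `R` is on average at most `A`, can be replaced by one of `n` messages. -/
theorem exists_code_of_relEntropy_le {X W κ : Type*} [Fintype X] [Fintype W] [Fintype κ]
    {mx : X → ℝ} (hmx : ∀ x, 0 ≤ mx x) (hmx1 : ∑ x, mx x = 1)
    {Q : X → W → ℝ} (hQ : ∀ x w, 0 ≤ Q x w) (hQ1 : ∀ x, ∑ w, Q x w = 1)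
    {R : W → ℝ} (hR : ∀ w, 0 ≤ R w) (hR1 : ∑ w, R w = 1)
    (hac : ∀ x w, R w = 0 → mx x * Q x w = 0)
    {h : X → W → ℝ} (h0 : ∀ x w, 0 ≤ h x w) (h1 : ∀ x w, h x w ≤ 1)
    {A δ η : ℝ} (hA0 : 0 ≤ A) (hδ : 0 < δ) (hδ1 : δ ≤ 1)
    (hA : relEntropy (fun i : X × W => mx i.1 * Q i.1 i.2) (fun i => mx i.1 * R i.2) ≤ A)
    (herr : ∑ x, mx x * ∑ w, Q x w * h x w ≤ η)
    (hcard : 4 / δ ^ 2 * Real.exp (1 + 4 * (A + 1) / δ ^ 2) ≤ Fintype.card κ) :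
    ∃ (code : κ → W) (msg : X → κ), ∑ x, mx x * h x (code (msg x)) ≤ η + 3 * δ := by
  -- Chosen so that `log K - 1 = 4 * (A + 1) / δ ^ 2`, which makes the average mass of messages with
  -- `Q x w ≥ K * R w` at most `δ ^ 2 / 4`.
  set K := Real.exp (1 + 4 * (A + 1) / δ ^ 2) with hK
  have hKpos : 0 < K := Real.exp_pos _
  have hn1 : 0 < 4 / δ ^ 2 * K := by positivity
  have hκ : Nonempty κ := by
    by_contra hne
    rw [not_nonempty_iff] at hne
    simp at hcard
    linarith
  choose best hbest using fun (x : X) (code : κ → W) => Finite.exists_min fun i => h x (code i)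
  -- the mass of the bad messages
  set b : X → ℝ := fun x => ∑ w, if K * R w ≤ Q x w then Q x w else 0 with hb
  have hb0 : ∀ x, 0 ≤ b x := fun x => Finset.sum_nonneg fun w _ => by
    split_ifs
    exacts [hQ x w, le_rfl]
  have hbsum : ∑ x, mx x * b x ≤ δ ^ 2 / 4 := by
    have h2 := sum_mul_log_sub_one_le (p := fun i : X × W => mx i.1 * Q i.1 i.2)
      (q := fun i => mx i.1 * R i.2) (fun i => mul_nonneg (hmx _) (hQ _ _))
      (fun i => mul_nonneg (hmx _) (hR _))
      (fun i hi => by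
        rcases mul_eq_zero.1 hi with h' | h'
        · simp [h']
        · exact hac _ _ h')
      (by simp [Fintype.sum_prod_type, ← Finset.mul_sum, hQ1, hR1])
      hKpos (Finset.univ.filter fun i : X × W => K * R i.2 ≤ Q i.1 i.2)
      (fun i hi => by
        have := mul_le_mul_of_nonneg_left (Finset.mem_filter.1 hi).2 (hmx i.1)
        linarith)
    rw [Finset.sum_filter, Fintype.sum_prod_type] at h2
    have h3 : ∑ x, ∑ w, (if K * R w ≤ Q x w then mx x * Q x w else 0) = ∑ x, mx x * b x := by
      refine Finset.sum_congr rfl fun x _ => ?_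
      rw [hb, Finset.mul_sum]
      refine Finset.sum_congr rfl fun w _ => ?_
      split_ifs <;> simp
    simp only [] at h2
    rw [h3, hK, Real.log_exp, add_sub_cancel_left] at h2
    have h4 : (∑ x, mx x * b x) * (4 * (A + 1)) ≤ A * δ ^ 2 := by
      rw [mul_div_assoc', div_le_iff₀ (by positivity)] at h2
      nlinarith [sq_nonneg δ]
    nlinarith [sq_nonneg δ]
  -- the expected cost of the best codeword
  have hx : ∀ x, mx x * ∑ code : κ → W, (∏ i, R (code i)) * h x (code (best x code)) ≤
      mx x * ∑ w, Q x w * h x w + mx x * (2 * δ) + 4 / δ * (mx x * b x) := by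
    intro x
    set e := ∑ w, Q x w * h x w with he
    have he0 : 0 ≤ e := Finset.sum_nonneg fun w _ => mul_nonneg (hQ x w) (h0 x w)
    have he1 : e ≤ 1 := by
      rw [← hQ1 x]
      exact Finset.sum_le_sum fun w _ => mul_le_of_le_one_right (hQ x w) (h1 x w)
    suffices ∑ code : κ → W, (∏ i, R (code i)) * h x (code (best x code)) ≤
        e + 2 * δ + 4 / δ * b x by
      have := mul_le_mul_of_nonneg_left this (hmx x)
      linarith
    -- Inputs with much bad mass are written off: there the term `4 / δ * b x` already exceeds the
    -- trivial bound `1`, and on average this term costs only `δ`.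
    by_cases hbx : δ / 4 < b x
    · have h2 : 1 ≤ 4 / δ * b x := by
        rw [div_mul_eq_mul_div, one_le_div hδ]
        linarith
      have h3 : ∑ code : κ → W, (∏ i, R (code i)) * h x (code (best x code)) ≤ 1 := by
        rw [← sum_prod_eq_one κ hR1]
        exact Finset.sum_le_sum fun code _ =>
          mul_le_of_le_one_right (Finset.prod_nonneg fun i _ => hR _) (h1 _ _)
      linarith
    · push Not at hbx
      -- By Markov, cheap messages have `Q x`-mass at least `δ / 2`. At most `δ / 4` of it is bad,
      -- and on the rest `Q x w < K * R w`, so `R` gives the cheap messages at least `δ / (4 * K)`.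
      have hg : δ / (4 * K) ≤ ∑ w, R w * (if h x w ≤ e + δ then 1 else 0) := by
        have h2 : ∑ w, Q x w * (if h x w ≤ e + δ then 0 else 1) ≤ e / (e + δ) := by
          rw [le_div_iff₀ (by positivity), Finset.sum_mul]
          refine Finset.sum_le_sum fun w _ => ?_
          split_ifs with hw
          · simpa using mul_nonneg (hQ x w) (h0 x w)
          · rw [mul_one]
            exact mul_le_mul_of_nonneg_left (not_le.1 hw).le (hQ x w)
        have h3 : e / (e + δ) ≤ 1 - δ / 2 := by
          rw [div_le_iff₀ (by positivity)]
          nlinarith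
        have h4 : ∀ w, Q x w ≤ K * (R w * (if h x w ≤ e + δ then 1 else 0)) +
            Q x w * (if h x w ≤ e + δ then 0 else 1) +
            (if K * R w ≤ Q x w then Q x w else 0) := by
          intro w
          have := hQ x w
          have := mul_nonneg hKpos.le (hR w)
          split_ifs <;> linarith
        have h5 := Finset.sum_le_sum fun w (_ : w ∈ Finset.univ) => h4 w
        rw [Finset.sum_add_distrib, Finset.sum_add_distrib, ← Finset.mul_sum, hQ1 x] at h5
        rw [div_le_iff₀ (by positivity)]
        simp only [hb] at hbx
        linarith
      have h2 := sum_codebook_min_le (κ := κ) hR hR1 (h1 x) (by positivity) hg hcard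
        (by positivity) hn1.le (fun code => h x (code (best x code))) (fun code => hbest x code)
      -- The codebook size is tuned so that having no cheap codeword costs exactly one more `δ`.
      have h3 : 1 / (δ / (4 * K) * (4 / δ ^ 2 * K)) = δ := by field_simp
      have h4 : 0 ≤ 4 / δ * b x := mul_nonneg (by positivity) (hb0 x)
      linarith
  have htot : ∑ code : κ → W, (∏ i, R (code i)) * ∑ x, mx x * h x (code (best x code)) ≤
      ∑ code : κ → W, (∏ i, R (code i)) * (η + 3 * δ) := by
    rw [← Finset.sum_mul, sum_prod_eq_one κ hR1, one_mul]
    have h2 : ∑ code : κ → W, (∏ i, R (code i)) * ∑ x, mx x * h x (code (best x code)) =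
        ∑ x, mx x * ∑ code : κ → W, (∏ i, R (code i)) * h x (code (best x code)) := by
      simp_rw [Finset.mul_sum]
      rw [Finset.sum_comm]
      exact Finset.sum_congr rfl fun x _ => Finset.sum_congr rfl fun c _ => by ring
    rw [h2]
    refine (Finset.sum_le_sum fun x _ => hx x).trans ?_
    rw [Finset.sum_add_distrib, Finset.sum_add_distrib, ← Finset.sum_mul, ← Finset.mul_sum, hmx1]
    have h3 := mul_le_mul_of_nonneg_left hbsum (by positivity : 0 ≤ 4 / δ)
    have h4 : 4 / δ * (δ ^ 2 / 4) = δ := by field_simp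
    linarith
  -- Probabilistic method: if every codebook, even with its best encoder, were too costly, the
  -- average over random codebooks would be too.
  by_contra hcon
  push Not at hcon
  have hpos : ∃ code : κ → W, 0 < ∏ i, R (code i) := by
    by_contra hz
    push Not at hz
    have := Finset.sum_nonpos fun code (_ : code ∈ Finset.univ) => hz code
    rw [sum_prod_eq_one κ hR1] at this
    linarith
  obtain ⟨code₀, hcode₀⟩ := hpos
  refine absurd htot (not_le.2 ?_)
  refine Finset.sum_lt_sum (fun code _ => mul_le_mul_of_nonneg_left (hcon code _).le
    (Finset.prod_nonneg fun i _ => hR _)) ⟨code₀, Finset.mem_univ _, ?_⟩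
  exact mul_lt_mul_of_pos_left (hcon code₀ fun x => best x code₀) hcode₀

/-- A message carrying very little information about the input is not needed. -/
theorem exists_constant_of_relEntropy_le {X W : Type*} [Fintype X] [Fintype W]
    {mx : X → ℝ} (hmx : ∀ x, 0 ≤ mx x) (hmx1 : ∑ x, mx x = 1)
    {Q : X → W → ℝ} (hQ : ∀ x w, 0 ≤ Q x w) (hQ1 : ∀ x, ∑ w, Q x w = 1)
    {R : W → ℝ} (hR : ∀ w, 0 ≤ R w) (hR1 : ∑ w, R w = 1)
    (hac : ∀ x w, R w = 0 → mx x * Q x w = 0)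
    {h : X → W → ℝ} (h0 : ∀ x w, 0 ≤ h x w) (h1 : ∀ x w, h x w ≤ 1)
    {δ η : ℝ} (hδ : 0 < δ)
    (hA : relEntropy (fun i : X × W => mx i.1 * Q i.1 i.2) (fun i => mx i.1 * R i.2) ≤ δ ^ 2)
    (herr : ∑ x, mx x * ∑ w, Q x w * h x w ≤ η) :
    ∃ w : W, ∑ x, mx x * h x w ≤ η + 3 * δ := by
  have h2 := sum_mul_le_add_relEntropy (p := fun i : X × W => mx i.1 * Q i.1 i.2)
      (q := fun i => mx i.1 * R i.2) (fun i => mul_nonneg (hmx _) (hQ _ _))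
      (fun i => mul_nonneg (hmx _) (hR _))
      (fun i hi => by
        rcases mul_eq_zero.1 hi with h' | h'
        · simp [h']
        · exact hac _ _ h')
      (by simp [Fintype.sum_prod_type, ← Finset.mul_sum, hQ1, hmx1])
      (by simp [Fintype.sum_prod_type, ← Finset.mul_sum, hR1, hmx1])
      hδ (fun i => h i.1 i.2) (fun i => h0 _ _) (fun i => h1 _ _)
  rw [Fintype.sum_prod_type, Fintype.sum_prod_type] at h2
  simp only [mul_assoc, ← Finset.mul_sum] at h2
  -- Pinsker is used with `s = δ`; replacing `Q x` by the input-independent `R` then costs at most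
  -- `δ + 2 * δ`, and some fixed `w` is at least as good as the `R`-average.
  have h3 : relEntropy (fun i : X × W => mx i.1 * Q i.1 i.2) (fun i => mx i.1 * R i.2) / (2 * δ) ≤
      δ := by
    rw [div_le_iff₀ (by positivity)]
    nlinarith [sq_nonneg δ]
  have h4 : ∑ x, mx x * ∑ w, R w * h x w = ∑ w, R w * ∑ x, mx x * h x w := by
    simp_rw [Finset.mul_sum]
    rw [Finset.sum_comm]
    exact Finset.sum_congr rfl fun x _ => Finset.sum_congr rfl fun c _ => by ring
  rw [h4] at h2
  have htot : ∑ w, R w * ∑ x, mx x * h x w ≤ ∑ w, R w * (η + 3 * δ) := by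
    rw [← Finset.sum_mul, hR1]
    linarith
  by_contra hcon
  push Not at hcon
  obtain ⟨w₀, hw₀⟩ : ∃ w, 0 < R w := by
    by_contra hz
    push Not at hz
    have := Finset.sum_nonpos fun w (_ : w ∈ Finset.univ) => hz w
    linarith
  refine absurd htot (not_le.2 ?_)
  exact Finset.sum_lt_sum (fun w _ => mul_le_mul_of_nonneg_left (hcon w).le (hR w))
    ⟨w₀, Finset.mem_univ _, mul_lt_mul_of_pos_left (hcon w₀) hw₀⟩

/-! ### Transcripts with product structure and Bob's decision -/

open Classical in
/-- The loss of the answer `z` on the input `x`, `y`. -/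
noncomputable def loss {X Y Z : Type*} (f : X → Y → Z → Prop) (x : X) (y : Y) (z : Z) : ℝ :=
  if f x y z then 0 else 1

lemma loss_nonneg {X Y Z : Type*} (f : X → Y → Z → Prop) (x : X) (y : Y) (z : Z) :
    0 ≤ loss f x y z := by
  rw [loss]; split_ifs <;> norm_num

lemma loss_le_one {X Y Z : Type*} (f : X → Y → Z → Prop) (x : X) (y : Y) (z : Z) :
    loss f x y z ≤ 1 := by
  rw [loss]; split_ifs <;> norm_num

/-- The average error of Bob's answer `out w y` to a message `w` with law `q x`. -/
noncomputable def avgError {X Y Z W : Type*} [Fintype X] [Fintype Y] [Fintype W] (f : X → Y → Z → Prop)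
    (mx : X → ℝ) (my : Y → ℝ) (q : X → W → ℝ) (out : W → Y → Z) : ℝ :=
  ∑ x, mx x * ∑ w, q x w * ∑ y, my y * loss f x y (out w y)

lemma sum_rearrange {X Y W : Type*} [Fintype X] [Fintype Y] [Fintype W]
    (mx : X → ℝ) (my : Y → ℝ) (q : X → W → ℝ) (g : X → W → Y → ℝ) :
    ∑ x, mx x * ∑ w, q x w * ∑ y, my y * g x w y =
      ∑ x, ∑ y, mx x * (my y * ∑ w, q x w * g x w y) := by
  refine Finset.sum_congr rfl fun x _ => ?_
  simp_rw [Finset.mul_sum]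
  rw [Finset.sum_comm]
  exact Finset.sum_congr rfl fun y _ => Finset.sum_congr rfl fun w _ => by ring

/-- Grouping by what Bob sees, the pair `w`, `y`, lets his answer be optimized separately for each
pair. -/
lemma sum_rearrange' {X Y W : Type*} [Fintype X] [Fintype Y] [Fintype W]
    (mx : X → ℝ) (my : Y → ℝ) (q : X → W → ℝ) (g : X → W → Y → ℝ) :
    ∑ x, mx x * ∑ w, q x w * ∑ y, my y * g x w y =
      ∑ w, ∑ y, my y * ∑ x, mx x * q x w * g x w y := by
  simp_rw [Finset.mul_sum]
  rw [Finset.sum_comm]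
  refine Finset.sum_congr rfl fun w _ => ?_
  rw [Finset.sum_comm]
  exact Finset.sum_congr rfl fun y _ => Finset.sum_congr rfl fun x _ => by ring

/-- On input `x`, `y` the transcript is `m` and Bob's answer lies in `S` with probability
`α x m * ν y m S`. -/
structure TranscriptModel (X Y M Z : Type*) [Fintype M] [MeasurableSpace Z] where
  α : X → M → ℝ
  ν : Y → M → MeasureTheory.Measure Z
  finite : ∀ y m, MeasureTheory.IsFiniteMeasure (ν y m)
  α_nonneg : ∀ x m, 0 ≤ α x m
  sum_eq_one : ∀ x y, ∑ m, α x m * (ν y m).real Set.univ = 1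

namespace TranscriptModel

variable {X Y M Z : Type*} [Fintype X] [Fintype Y] [Fintype M] [MeasurableSpace Z]
  (T : TranscriptModel X Y M Z)

/-- Bob's factor of the probability of a transcript. -/
noncomputable def β (y : Y) (m : M) : ℝ := (T.ν y m).real Set.univ

/-- The average of Bob's factors. -/
noncomputable def βbar (my : Y → ℝ) (m : M) : ℝ := ∑ y, my y * T.β y m

/-- The average of Alice's factors. -/
noncomputable def αbar (mx : X → ℝ) (m : M) : ℝ := ∑ x, mx x * T.α x m

/-- The law of the transcript given Alice's input. -/
noncomputable def lawX (my : Y → ℝ) (x : X) (m : M) : ℝ := T.α x m * T.βbar my m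

/-- The law of the transcript given Bob's input. -/
noncomputable def lawY (mx : X → ℝ) (y : Y) (m : M) : ℝ := T.αbar mx m * T.β y m

/-- The law of the transcript. -/
noncomputable def lawM (mx : X → ℝ) (my : Y → ℝ) (m : M) : ℝ := T.αbar mx m * T.βbar my m

open Classical in
/-- The weight that Bob attaches to a transcript sampled by Alice. -/
noncomputable def weight (my : Y → ℝ) (K : ℝ) (y : Y) (m : M) : ℝ :=
  if T.β y m ≤ K * T.βbar my m then (T.βbar my m)⁻¹ else 0

open Classical in
/-- The probability of the transcripts that Bob gives no weight. -/
noncomputable def bad (my : Y → ℝ) (K : ℝ) (x : X) (y : Y) : ℝ :=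
  ∑ m, if T.β y m ≤ K * T.βbar my m then 0 else T.α x m * T.β y m

instance (y : Y) (m : M) : MeasureTheory.IsFiniteMeasure (T.ν y m) := T.finite y m

lemma β_nonneg (y : Y) (m : M) : 0 ≤ T.β y m := MeasureTheory.measureReal_nonneg

variable {mx : X → ℝ} {my : Y → ℝ}

lemma βbar_nonneg (hmy : ∀ y, 0 ≤ my y) (m : M) : 0 ≤ T.βbar my m :=
  Finset.sum_nonneg fun y _ => mul_nonneg (hmy y) (T.β_nonneg y m)

lemma αbar_nonneg (hmx : ∀ x, 0 ≤ mx x) (m : M) : 0 ≤ T.αbar mx m :=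
  Finset.sum_nonneg fun x _ => mul_nonneg (hmx x) (T.α_nonneg x m)

lemma lawX_nonneg (hmy : ∀ y, 0 ≤ my y) (x : X) (m : M) : 0 ≤ T.lawX my x m :=
  mul_nonneg (T.α_nonneg x m) (T.βbar_nonneg hmy m)

lemma lawY_nonneg (hmx : ∀ x, 0 ≤ mx x) (y : Y) (m : M) : 0 ≤ T.lawY mx y m :=
  mul_nonneg (T.αbar_nonneg hmx m) (T.β_nonneg y m)

lemma lawM_nonneg (hmx : ∀ x, 0 ≤ mx x) (hmy : ∀ y, 0 ≤ my y) (m : M) : 0 ≤ T.lawM mx my m :=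
  mul_nonneg (T.αbar_nonneg hmx m) (T.βbar_nonneg hmy m)

lemma sum_α_mul_β (x : X) (y : Y) : ∑ m, T.α x m * T.β y m = 1 := T.sum_eq_one x y

lemma lawX_eq_sum (x : X) (m : M) :
    T.lawX my x m = ∑ y, my y * (T.α x m * T.β y m) := by
  rw [lawX, βbar, Finset.mul_sum]
  exact Finset.sum_congr rfl fun y _ => by ring

lemma lawY_eq_sum (y : Y) (m : M) :
    T.lawY mx y m = ∑ x, mx x * (T.α x m * T.β y m) := by
  rw [lawY, αbar, Finset.sum_mul]
  exact Finset.sum_congr rfl fun x _ => by ring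

lemma sum_lawX (hmy1 : ∑ y, my y = 1) (x : X) : ∑ m, T.lawX my x m = 1 := by
  simp_rw [lawX, βbar, Finset.mul_sum]
  rw [Finset.sum_comm, ← hmy1]
  refine Finset.sum_congr rfl fun y _ => ?_
  conv_rhs => rw [← mul_one (my y), ← T.sum_α_mul_β x y, Finset.mul_sum]
  exact Finset.sum_congr rfl fun m _ => by ring

lemma sum_lawY (hmx1 : ∑ x, mx x = 1) (y : Y) : ∑ m, T.lawY mx y m = 1 := by
  simp_rw [lawY, αbar, Finset.sum_mul]
  rw [Finset.sum_comm, ← hmx1]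
  refine Finset.sum_congr rfl fun x _ => ?_
  conv_rhs => rw [← mul_one (mx x), ← T.sum_α_mul_β x y, Finset.mul_sum]
  exact Finset.sum_congr rfl fun m _ => by ring

lemma sum_mul_lawX (m : M) : ∑ x, mx x * T.lawX my x m = T.lawM mx my m := by
  simp_rw [lawX, lawM, αbar, Finset.sum_mul, mul_assoc]

lemma sum_mul_lawY (m : M) : ∑ y, my y * T.lawY mx y m = T.lawM mx my m := by
  simp_rw [lawY, lawM, βbar, Finset.mul_sum]
  exact Finset.sum_congr rfl fun y _ => by ring

lemma sum_lawM (hmx1 : ∑ x, mx x = 1) (hmy1 : ∑ y, my y = 1) : ∑ m, T.lawM mx my m = 1 := by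
  simp_rw [← T.sum_mul_lawX]
  rw [Finset.sum_comm]
  simp_rw [← Finset.mul_sum, T.sum_lawX hmy1, mul_one, hmx1]

lemma mul_lawX_eq_zero (hmx : ∀ x, 0 ≤ mx x) (hmy : ∀ y, 0 ≤ my y) (x : X) (m : M)
    (h : T.lawM mx my m = 0) : mx x * T.lawX my x m = 0 := by
  rw [← T.sum_mul_lawX] at h
  exact (Finset.sum_eq_zero_iff_of_nonneg fun x _ =>
    mul_nonneg (hmx x) (T.lawX_nonneg hmy x m)).1 h x (Finset.mem_univ x)

lemma mul_lawY_eq_zero (hmx : ∀ x, 0 ≤ mx x) (hmy : ∀ y, 0 ≤ my y) (y : Y) (m : M)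
    (h : T.lawM mx my m = 0) : my y * T.lawY mx y m = 0 := by
  rw [← T.sum_mul_lawY] at h
  exact (Finset.sum_eq_zero_iff_of_nonneg fun y _ =>
    mul_nonneg (hmy y) (T.lawY_nonneg hmx y m)).1 h y (Finset.mem_univ y)

/-! ### Information carried by the transcript and the mass lost by truncation -/

/-- The information, in nats, that the transcript carries about Alice's input. -/
noncomputable def infoX (mx : X → ℝ) (my : Y → ℝ) : ℝ :=
  relEntropy (fun i : X × M => mx i.1 * T.lawX my i.1 i.2) (fun i => mx i.1 * T.lawM mx my i.2)

/-- The information, in nats, that the transcript carries about Bob's input. -/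
noncomputable def infoY (mx : X → ℝ) (my : Y → ℝ) : ℝ :=
  relEntropy (fun i : Y × M => my i.1 * T.lawY mx i.1 i.2) (fun i => my i.1 * T.lawM mx my i.2)

lemma infoX_nonneg (hmx : ∀ x, 0 ≤ mx x) (hmy : ∀ y, 0 ≤ my y) (hmx1 : ∑ x, mx x = 1)
    (hmy1 : ∑ y, my y = 1) : 0 ≤ T.infoX mx my :=
  relEntropy_nonneg (fun _ => mul_nonneg (hmx _) (T.lawX_nonneg hmy _ _))
    (fun _ => mul_nonneg (hmx _) (T.lawM_nonneg hmx hmy _))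
    (fun i hi => by
      rcases mul_eq_zero.1 hi with h' | h'
      · simp [h']
      · exact T.mul_lawX_eq_zero hmx hmy _ _ h')
    (by simp [Fintype.sum_prod_type, ← Finset.mul_sum, T.sum_lawX hmy1, T.sum_lawM hmx1 hmy1])

lemma infoY_nonneg (hmx : ∀ x, 0 ≤ mx x) (hmy : ∀ y, 0 ≤ my y) (hmx1 : ∑ x, mx x = 1)
    (hmy1 : ∑ y, my y = 1) : 0 ≤ T.infoY mx my :=
  relEntropy_nonneg (fun _ => mul_nonneg (hmy _) (T.lawY_nonneg hmx _ _))
    (fun _ => mul_nonneg (hmy _) (T.lawM_nonneg hmx hmy _))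
    (fun i hi => by
      rcases mul_eq_zero.1 hi with h' | h'
      · simp [h']
      · exact T.mul_lawY_eq_zero hmx hmy _ _ h')
    (by simp [Fintype.sum_prod_type, ← Finset.mul_sum, T.sum_lawY hmx1, T.sum_lawM hmx1 hmy1])

lemma bad_nonneg (K : ℝ) (x : X) (y : Y) : 0 ≤ T.bad my K x y :=
  Finset.sum_nonneg fun m _ => by
    split_ifs
    exacts [le_rfl, mul_nonneg (T.α_nonneg x m) (T.β_nonneg y m)]

-- Averaging over `x` replaces `α x` by `αbar`, so the truncated mass becomes mass of transcripts on
-- which the law given `y` exceeds `K` times the average law. The substate property bounds it by `B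
-- * δ / (B + 1)`, since `log K - 1 = (B + 1) / δ`.
open Classical in
lemma sum_bad_le (hmx : ∀ x, 0 ≤ mx x) (hmy : ∀ y, 0 ≤ my y) (hmx1 : ∑ x, mx x = 1)
    (hmy1 : ∑ y, my y = 1) {B δ : ℝ} (hB0 : 0 ≤ B) (hB : T.infoY mx my ≤ B) (hδ : 0 < δ) :
    ∑ x, ∑ y, mx x * (my y * T.bad my (Real.exp (1 + (B + 1) / δ)) x y) ≤ δ := by
  set K := Real.exp (1 + (B + 1) / δ) with hK
  have h2 := sum_mul_log_sub_one_le (p := fun i : Y × M => my i.1 * T.lawY mx i.1 i.2)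
    (q := fun i => my i.1 * T.lawM mx my i.2) (fun _ => mul_nonneg (hmy _) (T.lawY_nonneg hmx _ _))
    (fun _ => mul_nonneg (hmy _) (T.lawM_nonneg hmx hmy _))
    (fun i hi => by
      rcases mul_eq_zero.1 hi with h' | h'
      · simp [h']
      · exact T.mul_lawY_eq_zero hmx hmy _ _ h')
    (by simp [Fintype.sum_prod_type, ← Finset.mul_sum, T.sum_lawY hmx1, T.sum_lawM hmx1 hmy1])
    (Real.exp_pos (1 + (B + 1) / δ))
    (Finset.univ.filter fun i : Y × M => ¬ T.β i.1 i.2 ≤ K * T.βbar my i.2)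
    (fun i hi => by
      have h3 := (not_le.1 (Finset.mem_filter.1 hi).2).le
      have h4 := mul_le_mul_of_nonneg_left h3 (mul_nonneg (hmy i.1) (T.αbar_nonneg hmx i.2))
      simp only [lawM, lawY]
      linarith)
  rw [Finset.sum_filter, Fintype.sum_prod_type, Real.log_exp] at h2
  have h3 : ∑ x, ∑ y, mx x * (my y * T.bad my K x y) =
      ∑ y, ∑ m, if ¬ T.β y m ≤ K * T.βbar my m then my y * T.lawY mx y m else 0 := by
    rw [Finset.sum_comm]
    refine Finset.sum_congr rfl fun y _ => ?_
    simp_rw [bad, Finset.mul_sum]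
    rw [Finset.sum_comm]
    refine Finset.sum_congr rfl fun m _ => ?_
    by_cases h : T.β y m ≤ K * T.βbar my m
    · simp [h]
    · simp only [h, not_false_eq_true, if_true, if_false, lawY, αbar, Finset.sum_mul,
        Finset.mul_sum]
      exact Finset.sum_congr rfl fun x _ => by ring
  simp only [] at h2
  rw [← h3, add_sub_cancel_left, mul_div_assoc', div_le_iff₀ hδ] at h2
  change _ ≤ T.infoY mx my * δ at h2
  have h5 : (∑ x, ∑ y, mx x * (my y * T.bad my K x y)) * (B + 1) ≤ B * δ :=
    h2.trans (mul_le_mul_of_nonneg_right hB hδ.le)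
  nlinarith

/-! ### Importance weights -/

lemma weight_nonneg (hmy : ∀ y, 0 ≤ my y) (K : ℝ) (y : Y) (m : M) : 0 ≤ T.weight my K y m := by
  rw [weight]
  split_ifs
  exacts [inv_nonneg.2 (T.βbar_nonneg hmy m), le_rfl]

lemma weight_mul_β_le (hmy : ∀ y, 0 ≤ my y) {K : ℝ} (hK : 0 ≤ K) (y : Y) (m : M) :
    T.weight my K y m * T.β y m ≤ K := by
  rw [weight]
  split_ifs with h
  · rcases (T.βbar_nonneg hmy m).eq_or_lt with h' | h'
    · simp [← h', hK]
    · rw [inv_mul_le_iff₀ h']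
      linarith
  · simpa using hK

-- Change of measure: dividing by `βbar` removes Bob's averaged factor from Alice's sampling law,
-- and `s` supplies his actual factor. If `βbar my m = 0`, then `my y ≠ 0` forces `T.β y m = 0`,
-- hence `s = 0`.
open Classical in
lemma lawX_mul_weight (hmy : ∀ y, 0 ≤ my y) (K : ℝ) (x : X) {y : Y} (hy : my y ≠ 0) (m : M)
    {s : ℝ} (hs : |s| ≤ T.β y m) :
    T.lawX my x m * (T.weight my K y m * s) =
      if T.β y m ≤ K * T.βbar my m then T.α x m * s else 0 := by
  rw [weight, lawX]
  split_ifs with h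
  · by_cases h' : T.βbar my m = 0
    · have h2 := (Finset.sum_eq_zero_iff_of_nonneg fun y _ =>
        mul_nonneg (hmy y) (T.β_nonneg y m)).1 h' y (Finset.mem_univ y)
      have h3 : s = 0 := by
        rw [(mul_eq_zero.1 h2).resolve_left hy] at hs
        exact abs_nonpos_iff.1 hs
      simp [h3]
    · field_simp
  · simp

/-- Second moments of weighted transcripts. -/
lemma sum_lawX_mul_sq_le (hmy : ∀ y, 0 ≤ my y) {K : ℝ} (hK : 0 ≤ K) (x : X) {y : Y}
    (hy : my y ≠ 0) {s : M → ℝ} (hs : ∀ m, |s m| ≤ T.β y m) :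
    ∑ m, T.lawX my x m * (T.weight my K y m * s m) ^ 2 ≤ K := by
  have h1 : ∀ m, T.lawX my x m * (T.weight my K y m * s m) ^ 2 ≤ K * (T.α x m * T.β y m) := by
    intro m
    have hw := T.weight_nonneg hmy K y m
    have hb := T.β_nonneg y m
    -- Truncation bounds one factor of the square by `K`; the other factor is undone by the change
    -- of measure and has total at most `1`.
    have h2 : (T.weight my K y m * s m) ^ 2 ≤ K * (T.weight my K y m * T.β y m) := by
      rw [← sq_abs, abs_mul, abs_of_nonneg hw, sq]
      have h3 := mul_le_mul_of_nonneg_left (hs m) hw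
      exact mul_le_mul (h3.trans (T.weight_mul_β_le hmy hK y m)) h3
        (mul_nonneg hw (abs_nonneg _)) hK
    refine (mul_le_mul_of_nonneg_left h2 (T.lawX_nonneg hmy x m)).trans ?_
    rw [mul_left_comm, T.lawX_mul_weight hmy K x hy m (abs_of_nonneg hb).le]
    refine mul_le_mul_of_nonneg_left ?_ hK
    split_ifs
    exacts [le_rfl, mul_nonneg (T.α_nonneg x m) hb]
  refine (Finset.sum_le_sum fun m _ => h1 m).trans ?_
  rw [← Finset.mul_sum, T.sum_α_mul_β, mul_one]

open Classical in
/-- The weighted average over sampled transcripts is rarely much below its expectation. -/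
lemma sum_iid_indicator_le (hmy : ∀ y, 0 ≤ my y) (hmy1 : ∑ y, my y = 1) {K : ℝ} (hK : 0 ≤ K)
    (x : X) {y : Y} (hy : my y ≠ 0) {s : M → ℝ} (hs : ∀ m, |s m| ≤ T.β y m) {t r : ℝ} (hr : 0 < r)
    (hst : t + 2 * r ≤ ∑ m, T.α x m * s m) {N : ℕ} (hN : 0 < N) :
    ∑ w : Fin N → M, (∏ i, T.lawX my x (w i)) *
        (if ∑ i, T.weight my K y (w i) * s (w i) ≤ N * t then 1 else 0) ≤
      T.bad my K x y / r + K / (N * r ^ 2) := by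
  have hN' : (0 : ℝ) < N := by exact_mod_cast hN
  -- If the truncated mass is at most `r`, truncation uses up one `r` of the margin `2 * r` and
  -- Chebyshev the other. Otherwise the right-hand side is at least `1`.
  by_cases hb : T.bad my K x y ≤ r
  · have h1 : t + r ≤ ∑ m, T.lawX my x m * (T.weight my K y m * s m) := by
      have h2 : ∑ m, T.α x m * s m ≤
          ∑ m, T.lawX my x m * (T.weight my K y m * s m) + T.bad my K x y := by
        rw [bad, ← Finset.sum_add_distrib]
        refine Finset.sum_le_sum fun m _ => ?_
        rw [T.lawX_mul_weight hmy K x hy m (hs m)]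
        split_ifs
        · simp
        · rw [zero_add]
          exact mul_le_mul_of_nonneg_left ((le_abs_self _).trans (hs m)) (T.α_nonneg x m)
      linarith
    refine (sum_prod_indicator_le (fun m => T.lawX_nonneg hmy x m) (T.sum_lawX hmy1 x) _ hr
      (T.sum_lawX_mul_sq_le hmy hK x hy hs) h1 hN).trans ?_
    have := div_nonneg (T.bad_nonneg (my := my) K x y) hr.le
    linarith
  · have h1 : 1 ≤ T.bad my K x y / r := (one_le_div hr).2 (not_le.1 hb).le
    have h2 : 0 ≤ K / (N * r ^ 2) := by positivity
    have h3 : ∑ w : Fin N → M, (∏ i, T.lawX my x (w i)) *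
        (if ∑ i, T.weight my K y (w i) * s (w i) ≤ N * t then 1 else 0) ≤ 1 := by
      refine le_trans (Finset.sum_le_sum fun w _ => mul_le_of_le_one_right
        (Finset.prod_nonneg fun i _ => T.lawX_nonneg hmy x _) ?_)
        (sum_prod_eq_one (Fin N) (T.sum_lawX hmy1 x)).le
      split_ifs <;> norm_num
    linarith

/-- The model is correct for `f` with error at most `ε`. -/
def Computes (f : X → Y → Z → Prop) (ε : ℝ) : Prop :=
  ∀ x y, ∑ m, T.α x m * (T.ν y m).real {z | ¬ f x y z} ≤ ε

/-- Pointwise estimates are available only for `my y ≠ 0`, because of the change of measure; the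
remaining `y` do not contribute to the average. -/
lemma sum_sum_le_of_bad (hmx : ∀ x, 0 ≤ mx x) (hmy : ∀ y, 0 ≤ my y) (hmx1 : ∑ x, mx x = 1)
    (hmy1 : ∑ y, my y = 1) {B δ : ℝ} (hB0 : 0 ≤ B) (hB : T.infoY mx my ≤ B) (hδ : 0 < δ)
    {r c : ℝ} (hr : 0 < r) {E : X → Y → ℝ}
    (hE : ∀ x y, my y ≠ 0 → E x y ≤ T.bad my (Real.exp (1 + (B + 1) / δ)) x y / r + c) :
    ∑ x, ∑ y, mx x * (my y * E x y) ≤ δ / r + c := by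
  have h1 : ∀ x y, mx x * (my y * E x y) ≤
      (mx x * (my y * T.bad my (Real.exp (1 + (B + 1) / δ)) x y)) / r + mx x * (my y * c) := by
    intro x y
    by_cases hy : my y = 0
    · simp [hy]
    · have h2 := mul_le_mul_of_nonneg_left (mul_le_mul_of_nonneg_left (hE x y hy) (hmy y)) (hmx x)
      refine h2.trans (le_of_eq ?_)
      ring
  refine (Finset.sum_le_sum fun x _ => Finset.sum_le_sum fun y _ => h1 x y).trans ?_
  simp_rw [Finset.sum_add_distrib, ← Finset.sum_div, ← Finset.mul_sum, ← Finset.sum_mul, hmy1, hmx1]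
  have h3 := div_le_div_of_nonneg_right (T.sum_bad_le hmx hmy hmx1 hmy1 hB0 hB hδ) hr.le
  simp only [← Finset.mul_sum] at h3
  linarith

/-! ### Bob's decision rules -/

variable [DiscreteMeasurableSpace Z]

/-- Bob decides by a weighted majority vote if there is only one correct answer. -/
theorem exists_out_of_singleValued [Nonempty Z] (hmx : ∀ x, 0 ≤ mx x) (hmy : ∀ y, 0 ≤ my y)
    (hmx1 : ∑ x, mx x = 1) (hmy1 : ∑ y, my y = 1) {f : X → Y → Z → Prop} {ε : ℝ}
    (hf : SingleValued f) (hT : T.Computes f ε) (hε : ε < 1 / 2)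
    {B δ : ℝ} (hB0 : 0 ≤ B) (hB : T.infoY mx my ≤ B) (hδ : 0 < δ) {N : ℕ} (hN : 0 < N) :
    ∃ out : (Fin N → M) → Y → Z,
      avgError f mx my (fun x (w : Fin N → M) => ∏ i, T.lawX my x (w i)) out ≤
        δ / ((1 - 2 * ε) / 2) +
          Real.exp (1 + (B + 1) / δ) / (N * ((1 - 2 * ε) / 2) ^ 2) := by
  classical
  set K := Real.exp (1 + (B + 1) / δ) with hK
  have hKpos : 0 < K := Real.exp_pos _
  have hr : 0 < (1 - 2 * ε) / 2 := by linarith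
  -- A strict weighted majority against all other answers together, so there is at most one winner.
  let wins (w : Fin N → M) (y : Y) (z : Z) : Prop :=
    ∑ i, T.weight my K y (w i) * (T.ν y (w i)).real {z}ᶜ <
      ∑ i, T.weight my K y (w i) * (T.ν y (w i)).real {z}
  let out (w : Fin N → M) (y : Y) : Z :=
    if h : ∃ z, wins w y z then h.choose else Classical.arbitrary Z
  refine ⟨out, ?_⟩
  -- The signed vote has mean at least `1 - 2 * ε`, twice the margin `r`; Bob errs only if its
  -- weighted sum is at most `0`.
  let s (x : X) (y : Y) (m : M) : ℝ := (T.ν y m).real {z | f x y z} - (T.ν y m).real {z | ¬ f x y z}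
  have hsplit : ∀ x y m, (T.ν y m).real {z | f x y z} + (T.ν y m).real {z | ¬ f x y z} =
      T.β y m := fun x y m =>
    MeasureTheory.measureReal_add_measureReal_compl (s := {z | f x y z}) (.of_discrete)
  have hs : ∀ x y m, |s x y m| ≤ T.β y m := by
    intro x y m
    rw [← hsplit x y m, abs_le]
    have h1 : 0 ≤ (T.ν y m).real {z | f x y z} := MeasureTheory.measureReal_nonneg
    have h2 : 0 ≤ (T.ν y m).real {z | ¬ f x y z} := MeasureTheory.measureReal_nonneg
    constructor <;> simp only [s] <;> linarith
  have hpt : ∀ x w y, loss f x y (out w y) ≤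
      if ∑ i, T.weight my K y (w i) * s x y (w i) ≤ N * 0 then 1 else 0 := by
    intro x w y
    split_ifs with h
    · exact loss_le_one _ _ _ _
    rw [mul_zero, not_le] at h
    have h0 : ∃ z, f x y z := by
      by_contra hne
      push Not at hne
      refine absurd h (not_lt.2 (Finset.sum_nonpos fun i _ =>
        mul_nonpos_of_nonneg_of_nonpos (T.weight_nonneg hmy K y _) ?_))
      simp [s, hne]
    obtain ⟨z, hz⟩ := h0
    have hset : {z | f x y z} = {z} := by
      ext z'
      exact ⟨fun h' => hf x y z' z h' hz, fun h' => by rw [Set.mem_singleton_iff.1 h']; exact hz⟩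
    have hset' : {z | ¬ f x y z} = {z}ᶜ := by rw [← hset]; rfl
    have hwin : wins w y z := by
      simp only [s, mul_sub, Finset.sum_sub_distrib, hset, hset', sub_pos] at h
      exact h
    have hex : ∃ z, wins w y z := ⟨z, hwin⟩
    have hout : out w y = hex.choose := dif_pos hex
    have hwin' : wins w y (out w y) := hout ▸ hex.choose_spec
    have heq : out w y = z := by
      by_contra hne
      have h1 : ∑ i, T.weight my K y (w i) * (T.ν y (w i)).real {out w y} ≤
          ∑ i, T.weight my K y (w i) * (T.ν y (w i)).real {z}ᶜ :=
        Finset.sum_le_sum fun i _ => mul_le_mul_of_nonneg_left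
          (MeasureTheory.measureReal_mono (by simpa using Ne.symm hne)) (T.weight_nonneg hmy K y _)
      have h2 : ∑ i, T.weight my K y (w i) * (T.ν y (w i)).real {z} ≤
          ∑ i, T.weight my K y (w i) * (T.ν y (w i)).real {out w y}ᶜ :=
        Finset.sum_le_sum fun i _ => mul_le_mul_of_nonneg_left
          (MeasureTheory.measureReal_mono (by simpa using hne)) (T.weight_nonneg hmy K y _)
      simp only [wins] at hwin hwin'
      linarith
    rw [heq, loss, if_pos hz]
  rw [avgError, sum_rearrange]
  refine T.sum_sum_le_of_bad hmx hmy hmx1 hmy1 hB0 hB hδ hr fun x y hy => ?_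
  refine (Finset.sum_le_sum fun w _ => mul_le_mul_of_nonneg_left (hpt x w y)
    (Finset.prod_nonneg fun i _ => T.lawX_nonneg hmy x _)).trans ?_
  refine T.sum_iid_indicator_le hmy hmy1 hKpos.le x hy (hs x y) hr ?_ hN
  have h1 : ∀ m, T.α x m * s x y m =
      T.α x m * T.β y m - 2 * (T.α x m * (T.ν y m).real {z | ¬ f x y z}) := fun m => by
    rw [← hsplit x y m]
    simp only [s]
    ring
  simp_rw [h1, Finset.sum_sub_distrib, T.sum_α_mul_β, ← Finset.mul_sum]
  have := hT x y
  linarith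

/-- A best answer does at least as well as the answer in the model. -/
lemma exists_best_answer [Nonempty Z] (f : X → Y → Z → Prop) (y : Y) (τ : X → ℝ) :
    ∃ z₀, ∀ m, (∑ x, τ x * loss f x y z₀) * T.β y m ≤
      ∑ x, τ x * (T.ν y m).real {z | ¬ f x y z} := by
  classical
  -- `Z` may be infinite, but an answer matters only through the set of `x` for which it is correct,
  -- and `X` has finitely many subsets.
  obtain ⟨⟨p, z₀, hz₀⟩, hmin⟩ := Finite.exists_min
    fun p : Set.range (fun z => {x | f x y z}) => ∑ x, τ x * (if x ∈ p.1 then 0 else 1)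
  have hmin' : ∀ z, ∑ x, τ x * loss f x y z₀ ≤ ∑ x, τ x * loss f x y z := by
    intro z
    have := hmin ⟨_, z, rfl⟩
    subst hz₀
    simpa [loss] using this
  refine ⟨z₀, fun m => ?_⟩
  have hl : ∀ x, (fun z => loss f x y z) = Set.indicator {z | ¬ f x y z} 1 := fun x => by
    ext z
    by_cases h : f x y z <;> simp [loss, h]
  have hint : ∀ x, MeasureTheory.Integrable (fun z => τ x * loss f x y z) (T.ν y m) := fun x => by
    refine MeasureTheory.Integrable.const_mul ?_ _
    change MeasureTheory.Integrable (fun z => loss f x y z) _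
    rw [hl]
    exact (MeasureTheory.integrable_const (1 : ℝ)).indicator (.of_discrete)
  -- Integrate the minimality of `z₀` against Bob's answer measure; `z₀` does not depend on `m`, so
  -- it serves all samples at once.
  have h1 := MeasureTheory.integral_mono (μ := T.ν y m) (MeasureTheory.integrable_const _)
    (MeasureTheory.integrable_finsetSum Finset.univ fun x _ => hint x) hmin'
  rw [MeasureTheory.integral_const, MeasureTheory.integral_finsetSum _ fun x _ => hint x] at h1
  rw [mul_comm]
  refine h1.trans (le_of_eq (Finset.sum_congr rfl fun x _ => ?_))
  rw [MeasureTheory.integral_const_mul, hl, MeasureTheory.integral_indicator_one (.of_discrete)]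

/-- Bob decides by minimizing his expected error. -/
theorem exists_out [Nonempty Z] (hmx : ∀ x, 0 ≤ mx x) (hmy : ∀ y, 0 ≤ my y)
    (hmx1 : ∑ x, mx x = 1) (hmy1 : ∑ y, my y = 1) {f : X → Y → Z → Prop} {ε : ℝ}
    (hT : T.Computes f ε)
    {B δ r : ℝ} (hB0 : 0 ≤ B) (hB : T.infoY mx my ≤ B) (hδ : 0 < δ) (hr : 0 < r) (hr1 : 2 * r < 1)
    {N : ℕ} (hN : 0 < N) :
    ∃ out : (Fin N → M) → Y → Z,
      avgError f mx my (fun x (w : Fin N → M) => ∏ i, T.lawX my x (w i)) out ≤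
        δ / r + (Real.exp (1 + (B + 1) / δ) / (N * r ^ 2) + ε / (1 - 2 * r)) := by
  classical
  set K := Real.exp (1 + (B + 1) / δ) with hK
  have hKpos : 0 < K := Real.exp_pos _
  have hN' : (0 : ℝ) < N := by exact_mod_cast hN
  set θ := 1 - 2 * r with hθ
  have hθ0 : 0 < θ := by linarith
  set q : X → (Fin N → M) → ℝ := fun x w => ∏ i, T.lawX my x (w i) with hq
  have hq0 : ∀ x w, 0 ≤ q x w := fun x w => Finset.prod_nonneg fun i _ => T.lawX_nonneg hmy x _
  -- Up to normalization, `mx x * q x w` is the posterior of Alice's input given the samples.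
  choose out hout using fun (w : Fin N → M) (y : Y) =>
    T.exists_best_answer f y fun x => mx x * q x w
  refine ⟨out, ?_⟩
  -- The weighted error is divided by the fixed number `N * θ` instead of the actual total weight.
  -- It is then a sum over samples with mean at most `ε / θ`, and the indicator pays for a total
  -- weight below `N * θ`.
  let g (x : X) (w : Fin N → M) (y : Y) : ℝ :=
    (∑ i, T.weight my K y (w i) * (T.ν y (w i)).real {z | ¬ f x y z}) / (N * θ) +
      if ∑ i, T.weight my K y (w i) * T.β y (w i) ≤ N * θ then 1 else 0
  have hg1 : ∀ x (w : Fin N → M) y, 0 ≤ (∑ i, T.weight my K y (w i) * (T.ν y (w i)).real {z | ¬ f x y z}) /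
      (N * θ) := fun x w y => div_nonneg (Finset.sum_nonneg fun i _ =>
    mul_nonneg (T.weight_nonneg hmy K y _) MeasureTheory.measureReal_nonneg) (by positivity)
  have hpt : ∀ w y, ∑ x, mx x * q x w * loss f x y (out w y) ≤ ∑ x, mx x * q x w * g x w y := by
    intro w y
    by_cases h : ∑ i, T.weight my K y (w i) * T.β y (w i) ≤ N * θ
    · refine Finset.sum_le_sum fun x _ => mul_le_mul_of_nonneg_left ?_
        (mul_nonneg (hmx x) (hq0 x w))
      simp only [g, h, if_true]
      have := hg1 x w y
      have := loss_le_one f x y (out w y)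
      linarith
    · simp only [g, h, if_false, add_zero, mul_div_assoc']
      rw [← Finset.sum_div, le_div_iff₀ (by positivity)]
      have h1 : 0 ≤ ∑ x, mx x * q x w * loss f x y (out w y) := Finset.sum_nonneg fun x _ =>
        mul_nonneg (mul_nonneg (hmx x) (hq0 x w)) (loss_nonneg _ _ _ _)
      refine (mul_le_mul_of_nonneg_left (not_le.1 h).le h1).trans ?_
      have h2 := Finset.sum_le_sum fun i (_ : i ∈ Finset.univ) =>
        mul_le_mul_of_nonneg_left (hout w y (w i)) (T.weight_nonneg hmy K y (w i))
      simp_rw [Finset.mul_sum] at h2 ⊢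
      rw [Finset.sum_comm (s := Finset.univ (α := X))]
      refine le_trans (le_of_eq ?_) (h2.trans (le_of_eq ?_))
      · exact Finset.sum_congr rfl fun i _ => by ring
      · exact Finset.sum_congr rfl fun i _ => Finset.sum_congr rfl fun x _ => by ring
  rw [avgError, sum_rearrange' mx my q fun x w y => loss f x y (out w y)]
  refine (Finset.sum_le_sum fun w _ => Finset.sum_le_sum fun y _ =>
    mul_le_mul_of_nonneg_left (hpt w y) (hmy y)).trans ?_
  rw [← sum_rearrange' mx my q g, sum_rearrange]
  refine T.sum_sum_le_of_bad hmx hmy hmx1 hmy1 hB0 hB hδ hr fun x y hy => ?_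
  have hβ : ∀ m, |T.β y m| ≤ T.β y m := fun m => (abs_of_nonneg (T.β_nonneg y m)).le
  have h1 := T.sum_iid_indicator_le hmy hmy1 hKpos.le x hy hβ (t := θ) hr
    (by rw [T.sum_α_mul_β]; linarith) hN
  have hν : ∀ m, |(T.ν y m).real {z | ¬ f x y z}| ≤ T.β y m := fun m => by
    rw [abs_of_nonneg MeasureTheory.measureReal_nonneg]
    exact MeasureTheory.measureReal_mono (Set.subset_univ _)
  have h2 : ∑ w, q x w *
      ((∑ i, T.weight my K y (w i) * (T.ν y (w i)).real {z | ¬ f x y z}) / (N * θ)) ≤ ε / θ := by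
    simp_rw [mul_div_assoc', ← Finset.sum_div]
    rw [sum_prod_mul_sum (T.sum_lawX hmy1 x)
      (fun m => T.weight my K y m * (T.ν y m).real {z | ¬ f x y z}), mul_div_mul_left _ _ hN'.ne']
    refine div_le_div_of_nonneg_right (le_trans (Finset.sum_le_sum fun m _ => ?_) (hT x y)) hθ0.le
    rw [T.lawX_mul_weight hmy K x hy m (hν m)]
    split_ifs
    exacts [le_rfl, mul_nonneg (T.α_nonneg x m) MeasureTheory.measureReal_nonneg]
  simp only [g, mul_add, Finset.sum_add_distrib]
  linarith

end TranscriptModel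

/-! ### One-way protocols from transcripts with product structure -/

lemma relEntropy_prod_eq_sum {X W : Type*} [Fintype X] [Fintype W] (mx : X → ℝ) (Q : X → W → ℝ)
    (R : W → ℝ) :
    relEntropy (fun i : X × W => mx i.1 * Q i.1 i.2) (fun i => mx i.1 * R i.2) =
      ∑ x, mx x * relEntropy (Q x) R := by
  rw [relEntropy, Fintype.sum_prod_type]
  refine Finset.sum_congr rfl fun x _ => ?_
  by_cases hx : mx x = 0
  · simp [hx]
  rw [relEntropy, Finset.mul_sum]
  exact Finset.sum_congr rfl fun w _ => by rw [mul_div_mul_left _ _ hx, mul_assoc]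

/-- Rounding up turns the factor `D` into at most `D + 1 = exp (log (D + 1))`, which is absorbed
into the exponent because `B + 1 ≥ 1`. -/
lemma exists_sample_size {D δ B : ℝ} (hD : 0 < D) (hδ : 0 < δ) (hB : 0 ≤ B) :
    ∃ N : ℕ, 0 < N ∧ D * Real.exp (1 + (B + 1) / δ) ≤ N ∧
      (N : ℝ) ≤ Real.exp ((Real.log (D + 1) + 1 + 1 / δ) * (B + 1)) := by
  have h1 : 0 < D * Real.exp (1 + (B + 1) / δ) := by positivity
  refine ⟨⌈D * Real.exp (1 + (B + 1) / δ)⌉₊, Nat.ceil_pos.2 h1, Nat.le_ceil _, ?_⟩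
  refine (Nat.ceil_lt_add_one h1.le).le.trans ?_
  have h2 : 1 ≤ Real.exp (1 + (B + 1) / δ) := Real.one_le_exp (by positivity)
  have h3 : D * Real.exp (1 + (B + 1) / δ) + 1 ≤
      Real.exp (Real.log (D + 1)) * Real.exp (1 + (B + 1) / δ) := by
    rw [Real.exp_log (by positivity)]
    linarith
  refine h3.trans ?_
  rw [← Real.exp_add, Real.exp_le_exp]
  have h4 : 0 ≤ Real.log (D + 1) := Real.log_nonneg (by linarith)
  have h5 : (Real.log (D + 1) + 1 + 1 / δ) * (B + 1) =
    Real.log (D + 1) + (1 + (B + 1) / δ) + (Real.log (D + 1) + 1) * B := by ring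
  rw [h5]
  have : 0 ≤ (Real.log (D + 1) + 1) * B := by positivity
  linarith

universe uX uY uZ

namespace TranscriptModel

/-- Bob can answer from few transcripts sampled by Alice. -/
theorem exists_decision {ε ε' : ℝ} (hε : 0 < ε) (hεε' : ε ≤ ε') (hε' : ε' < 1 / 2) :
    ∃ c η : ℝ, 0 < c ∧ η < ε' ∧ ∀ (X : Type uX) (Y : Type uY) (M : Type) (Z : Type uZ)
      [Fintype X] [Fintype Y] [Fintype M] [MeasurableSpace Z] [DiscreteMeasurableSpace Z]
      [Nonempty Z] (T : TranscriptModel X Y M Z) (f : X → Y → Z → Prop) (mx : X → ℝ) (my : Y → ℝ)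
      (B : ℝ), (ε < ε' ∨ SingleValued f) → T.Computes f ε → (∀ x, 0 ≤ mx x) → (∀ y, 0 ≤ my y) →
      ∑ x, mx x = 1 → ∑ y, my y = 1 → 0 ≤ B → T.infoY mx my ≤ B →
      ∃ N : ℕ, 0 < N ∧ (N : ℝ) ≤ Real.exp (c * (B + 1)) ∧ ∃ out : (Fin N → M) → Y → Z,
        avgError f mx my (fun x (w : Fin N → M) => ∏ i, T.lawX my x (w i)) out ≤ η := by
  rcases hεε'.lt_or_eq with hlt | heq
  -- Error budget: `γ / 8` for truncation, `γ / 8` for Chebyshev, and `γ / 4` for the loss from `ε`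
  -- to `ε / (1 - 2 * r)`.
  · set γ := ε' - ε with hγ
    have hγ0 : 0 < γ := by linarith
    set r := γ / 8 with hr
    have hr0 : 0 < r := by positivity
    set δ := r * (γ / 8) with hδ
    have hδ0 : 0 < δ := by positivity
    set D := 8 / (γ * r ^ 2) with hD
    have hD0 : 0 < D := by positivity
    have hlog : 0 ≤ Real.log (D + 1) := Real.log_nonneg (by linarith)
    refine ⟨Real.log (D + 1) + 1 + 1 / δ, ε + γ / 2, by positivity, by linarith, ?_⟩
    intro X Y M Z _ _ _ _ _ _ T f mx my B _ hT hmx hmy hmx1 hmy1 hB0 hB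
    obtain ⟨N, hN, hN1, hN2⟩ := exists_sample_size hD0 hδ0 hB0
    obtain ⟨out, hout⟩ := T.exists_out hmx hmy hmx1 hmy1 hT hB0 hB hδ0 hr0
      (by linarith) hN
    refine ⟨N, hN, hN2, out, hout.trans ?_⟩
    have hN' : (0 : ℝ) < N := by exact_mod_cast hN
    have h1 : δ / r = γ / 8 := by rw [hδ]; field_simp
    have h2 : Real.exp (1 + (B + 1) / δ) / (N * r ^ 2) ≤ γ / 8 := by
      rw [div_le_iff₀ (by positivity)]
      rw [hD, div_mul_eq_mul_div, div_le_iff₀ (by positivity)] at hN1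
      nlinarith
    have h3 : ε / (1 - 2 * r) ≤ ε + γ / 4 := by
      rw [div_le_iff₀ (by linarith)]
      nlinarith
    linarith
  -- With a unique correct answer the vote amplifies: error `ε / 2` is reached, and the other half
  -- is left for compression.
  · subst heq
    set r := (1 - 2 * ε) / 2 with hr
    have hr0 : 0 < r := by linarith
    set δ := r * (ε / 4) with hδ
    have hδ0 : 0 < δ := by positivity
    set D := 4 / (ε * r ^ 2) with hD
    have hD0 : 0 < D := by positivity
    have hlog : 0 ≤ Real.log (D + 1) := Real.log_nonneg (by linarith)
    refine ⟨Real.log (D + 1) + 1 + 1 / δ, ε / 2, by positivity, by linarith, ?_⟩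
    intro X Y M Z _ _ _ _ _ _ T f mx my B hf hT hmx hmy hmx1 hmy1 hB0 hB
    obtain ⟨N, hN, hN1, hN2⟩ := exists_sample_size hD0 hδ0 hB0
    obtain ⟨out, hout⟩ := T.exists_out_of_singleValued hmx hmy hmx1 hmy1
      (hf.resolve_left (lt_irrefl _)) hT hε' hB0 hB hδ0 hN
    refine ⟨N, hN, hN2, out, hout.trans ?_⟩
    rw [← hr]
    have hN' : (0 : ℝ) < N := by exact_mod_cast hN
    have h1 : δ / r = ε / 4 := by rw [hδ]; field_simp
    have h2 : Real.exp (1 + (B + 1) / δ) / (N * r ^ 2) ≤ ε / 4 := by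
      rw [div_le_iff₀ (by positivity)]
      rw [hD, div_mul_eq_mul_div, div_le_iff₀ (by positivity)] at hN1
      nlinarith
    linarith

/-- The one-way simulation of a transcript with product structure. -/
theorem exists_oneWay {ε ε' : ℝ} (hε : 0 < ε) (hεε' : ε ≤ ε') (hε' : ε' < 1 / 2) :
    ∃ C : ℝ, 0 < C ∧ ∀ (X : Type uX) (Y : Type uY) (M : Type) (Z : Type uZ)
      [Fintype X] [Fintype Y] [Fintype M] [MeasurableSpace Z] [DiscreteMeasurableSpace Z]
      [Nonempty Z] (T : TranscriptModel X Y M Z) (f : X → Y → Z → Prop) (mx : X → ℝ) (my : Y → ℝ)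
      (A B : ℝ), (ε < ε' ∨ SingleValued f) → T.Computes f ε → (∀ x, 0 ≤ mx x) → (∀ y, 0 ≤ my y) →
      ∑ x, mx x = 1 → ∑ y, my y = 1 → T.infoX mx my ≤ A → T.infoY mx my ≤ B →
      ∃ c : ℕ, (c : ℝ) ≤ A * Real.exp (C * (B + 1)) ∧
        ∃ (msg : X → (Fin c → Bool)) (out : (Fin c → Bool) → Y → Z),
          ∑ x, mx x * ∑ y, my y * loss f x y (out (msg x) y) ≤ ε' := by
  obtain ⟨c₀, η, hc₀, hη, hdec⟩ := exists_decision.{uX, uY, uZ} hε hεε' hε'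
  set δ := min ((ε' - η) / 3) 1 with hδ
  have hδ0 : 0 < δ := lt_min (by linarith) one_pos
  have hδ1 : δ ≤ 1 := min_le_right _ _
  have hδη : η + 3 * δ ≤ ε' := by
    have := min_le_left ((ε' - η) / 3) 1
    linarith
  have hlog2 : 0 < Real.log 2 := Real.log_pos one_lt_two
  have hδsq : δ ^ 2 ≤ 1 := pow_le_one₀ hδ0.le hδ1
  have hlogδ : 0 ≤ Real.log (4 / δ ^ 2) := Real.log_nonneg (by
    rw [le_div_iff₀ (by positivity)]; linarith)
  set C₁ := (Real.log (4 / δ ^ 2) + 1 + 4 / δ ^ 2) / Real.log 2 + 1 with hC₁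
  have hC₁0 : 0 < C₁ := by positivity
  set C₂ := C₁ * (1 + 1 / δ ^ 2) with hC₂
  have hC₂0 : 0 < C₂ := by positivity
  refine ⟨c₀ + C₂, by positivity, ?_⟩
  intro X Y M Z _ _ _ _ _ _ T f mx my A B hf hT hmx hmy hmx1 hmy1 hA hB
  have hA0 : 0 ≤ A := (T.infoX_nonneg hmx hmy hmx1 hmy1).trans hA
  have hB0 : 0 ≤ B := (T.infoY_nonneg hmx hmy hmx1 hmy1).trans hB
  obtain ⟨N, hN, hNle, out, hout⟩ :=
    hdec X Y M Z T f mx my B hf hT hmx hmy hmx1 hmy1 hB0 hB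
  have hN' : (0 : ℝ) < N := by exact_mod_cast hN
  set Q : X → (Fin N → M) → ℝ := fun x w => ∏ i, T.lawX my x (w i) with hQ
  set R : (Fin N → M) → ℝ := fun w => ∏ i, T.lawM mx my (w i) with hR
  have hQ0 : ∀ x w, 0 ≤ Q x w := fun x w => Finset.prod_nonneg fun i _ => T.lawX_nonneg hmy x _
  have hQ1 : ∀ x, ∑ w, Q x w = 1 := fun x => sum_prod_eq_one (Fin N) (T.sum_lawX hmy1 x)
  have hR0 : ∀ w, 0 ≤ R w := fun w => Finset.prod_nonneg fun i _ => T.lawM_nonneg hmx hmy _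
  have hR1 : ∑ w, R w = 1 := sum_prod_eq_one (Fin N) (T.sum_lawM hmx1 hmy1)
  have hac1 : ∀ x m, mx x ≠ 0 → T.lawM mx my m = 0 → T.lawX my x m = 0 := fun x m hx hm =>
    (mul_eq_zero.1 (T.mul_lawX_eq_zero hmx hmy x m hm)).resolve_left hx
  have hac : ∀ x w, R w = 0 → mx x * Q x w = 0 := by
    intro x w hw
    by_cases hx : mx x = 0
    · simp [hx]
    obtain ⟨i, -, hi⟩ := Finset.prod_eq_zero_iff.1 hw
    rw [hQ]
    simp only []
    rw [Finset.prod_eq_zero (Finset.mem_univ i) (hac1 x _ hx hi), mul_zero]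
  have hrel : relEntropy (fun i : X × (Fin N → M) => mx i.1 * Q i.1 i.2)
      (fun i => mx i.1 * R i.2) = N * T.infoX mx my := by
    rw [infoX, relEntropy_prod_eq_sum, relEntropy_prod_eq_sum, Finset.mul_sum]
    refine Finset.sum_congr rfl fun x _ => ?_
    by_cases hx : mx x = 0
    · simp [hx]
    rw [hQ, hR, relEntropy_iid (T.sum_lawX hmy1 x) (fun m => hac1 x m hx), mul_left_comm]
  have hrelA : relEntropy (fun i : X × (Fin N → M) => mx i.1 * Q i.1 i.2)
      (fun i => mx i.1 * R i.2) ≤ N * A := by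
    rw [hrel]
    exact mul_le_mul_of_nonneg_left hA hN'.le
  set h : X → (Fin N → M) → ℝ := fun x w => ∑ y, my y * loss f x y (out w y) with hh
  have h0 : ∀ x w, 0 ≤ h x w := fun x w =>
    Finset.sum_nonneg fun y _ => mul_nonneg (hmy y) (loss_nonneg _ _ _ _)
  have h1 : ∀ x w, h x w ≤ 1 := fun x w => by
    rw [← hmy1]
    exact Finset.sum_le_sum fun y _ => mul_le_of_le_one_right (hmy y) (loss_le_one _ _ _ _)
  -- This split makes the bound proportional to `A`: below the threshold no bit is sent, above it `1
  -- ≤ N * A / δ ^ 2` absorbs every additive constant.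
  by_cases hsmall : N * A ≤ δ ^ 2
  · obtain ⟨w, hw⟩ := exists_constant_of_relEntropy_le hmx hmx1 hQ0 hQ1 hR0 hR1 hac h0 h1 hδ0
      (hrelA.trans hsmall) hout
    exact ⟨0, by push_cast; positivity, fun _ => Fin.elim0, fun _ => out w, hw.trans hδη⟩
  · push Not at hsmall
    -- The binary logarithm of the required codebook size, rounded up.
    set c := ⌈(Real.log (4 / δ ^ 2) + (1 + 4 * (N * A + 1) / δ ^ 2)) / Real.log 2⌉₊ with hc
    have hNA : 0 ≤ N * A := by positivity
    have hcard : 4 / δ ^ 2 * Real.exp (1 + 4 * (N * A + 1) / δ ^ 2) ≤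
        Fintype.card (Fin c → Bool) := by
      have h2 := Nat.le_ceil ((Real.log (4 / δ ^ 2) + (1 + 4 * (N * A + 1) / δ ^ 2)) / Real.log 2)
      rw [← hc, div_le_iff₀ hlog2] at h2
      have h3 : ((Fintype.card (Fin c → Bool) : ℕ) : ℝ) = Real.exp (c * Real.log 2) := by
        rw [Real.exp_nat_mul, Real.exp_log two_pos]
        simp
      rw [h3]
      refine le_trans (le_of_eq ?_) (Real.exp_le_exp.2 h2)
      rw [Real.exp_add (Real.log _), Real.exp_log (by positivity)]
    obtain ⟨code, msg, hmsg⟩ := exists_code_of_relEntropy_le hmx hmx1 hQ0 hQ1 hR0 hR1 hac h0 h1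
      hNA hδ0 hδ1 hrelA hout hcard
    refine ⟨c, ?_, msg, fun i => out (code i), hmsg.trans hδη⟩
    have h2 : (c : ℝ) ≤ C₁ * (N * A + 1) := by
      refine (Nat.ceil_lt_add_one (by positivity)).le.trans ?_
      rw [hC₁, add_mul, div_mul_eq_mul_div]
      refine add_le_add (div_le_div_of_nonneg_right ?_ hlog2.le) (by linarith)
      have h4 : (Real.log (4 / δ ^ 2) + 1 + 4 / δ ^ 2) * (N * A + 1) =
        Real.log (4 / δ ^ 2) + (1 + 4 * (N * A + 1) / δ ^ 2) +
          (Real.log (4 / δ ^ 2) + 1) * (N * A) := by ring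
      rw [h4]
      have : 0 ≤ (Real.log (4 / δ ^ 2) + 1) * (N * A) := by positivity
      linarith
    have h3 : (c : ℝ) ≤ C₂ * (N * A) := by
      refine h2.trans ?_
      rw [hC₂, mul_assoc]
      refine mul_le_mul_of_nonneg_left ?_ hC₁0.le
      have : 1 ≤ 1 / δ ^ 2 * (N * A) := by
        rw [one_div_mul_eq_div, one_le_div (by positivity)]
        exact hsmall.le
      linarith
    have h4 : C₂ ≤ Real.exp (C₂ * (B + 1)) := by
      have := Real.add_one_le_exp (C₂ * (B + 1))
      nlinarith
    have h5 : C₂ * N ≤ Real.exp ((c₀ + C₂) * (B + 1)) := by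
      rw [add_mul, add_comm, Real.exp_add]
      exact mul_le_mul h4 hNle hN'.le (Real.exp_pos _).le
    have := mul_le_mul_of_nonneg_right h5 hA0
    linarith

end TranscriptModel

/-! ### Rectangle structure of protocol trees -/

namespace ProtocolTree

variable {A B : Type*}

/-- Alice's messages in the transcript are those that she sends when she holds `a`. -/
def AliceConsistent : (t : ProtocolTree A B) → A → t.Transcript → Prop
  | leaf, _, _ => True
  | alice send next, a, m => send a = m.1 ∧ AliceConsistent (next m.1) a m.2
  | bob _ next, a, m => AliceConsistent (next m.1) a m.2

/-- Bob's messages in the transcript are those that he sends when he holds `b`. -/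
def BobConsistent : (t : ProtocolTree A B) → B → t.Transcript → Prop
  | leaf, _, _ => True
  | alice _ next, b, m => BobConsistent (next m.1) b m.2
  | bob send next, b, m => send b = m.1 ∧ BobConsistent (next m.1) b m.2

/-- Each bit is a function of one party's data and the past, so the data pairs producing a given
transcript form a rectangle. -/
lemma run_eq_iff : (t : ProtocolTree A B) → (a : A) → (b : B) → (m : t.Transcript) →
    (t.run a b = m ↔ t.AliceConsistent a m ∧ t.BobConsistent b m)
  | leaf, _, _, _ => ⟨fun _ => ⟨trivial, trivial⟩, fun _ => rfl⟩
  | alice send next, a, b, ⟨i, m⟩ => by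
    constructor
    · intro h
      obtain ⟨h1, h2⟩ := Sigma.mk.inj_iff.1 h
      subst h1
      have h3 := (run_eq_iff (next (send a)) a b m).1 (eq_of_heq h2)
      exact ⟨⟨rfl, h3.1⟩, h3.2⟩
    · rintro ⟨⟨h1, h2⟩, h3⟩
      change send a = i at h1
      subst h1
      exact Sigma.mk.inj_iff.2
        ⟨rfl, heq_of_eq ((run_eq_iff (next (send a)) a b m).2 ⟨h2, h3⟩)⟩
  | bob send next, a, b, ⟨i, m⟩ => by
    constructor
    · intro h
      obtain ⟨h1, h2⟩ := Sigma.mk.inj_iff.1 h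
      subst h1
      have h3 := (run_eq_iff (next (send b)) a b m).1 (eq_of_heq h2)
      exact ⟨h3.1, ⟨rfl, h3.2⟩⟩
    · rintro ⟨h2, ⟨h1, h3⟩⟩
      change send b = i at h1
      subst h1
      exact Sigma.mk.inj_iff.2
        ⟨rfl, heq_of_eq ((run_eq_iff (next (send b)) a b m).2 ⟨h2, h3⟩)⟩

end ProtocolTree

/-! ### Probabilities of independent events -/

lemma pmf_sum_toReal {α : Type*} [Fintype α] (p : PMF α) : ∑ a, (p a).toReal = 1 := by
  rw [← ENNReal.toReal_sum fun a _ => p.apply_ne_top a, ← tsum_fintype (L := .unconditional _),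
    p.tsum_coe, ENNReal.toReal_one]

lemma toOuterMeasure_le_one {α : Type*} (p : PMF α) (s : Set α) : p.toOuterMeasure s ≤ 1 := by
  rw [p.toOuterMeasure_apply, ← p.tsum_coe]
  exact ENNReal.tsum_le_tsum fun a => Set.indicator_le_self _ _ a

lemma toOuterMeasure_ne_top {α : Type*} (p : PMF α) (s : Set α) : p.toOuterMeasure s ≠ ⊤ :=
  ((toOuterMeasure_le_one p s).trans_lt ENNReal.one_lt_top).ne

open Classical in
/-- The indicator of a proposition. -/
noncomputable def propIndicator (p : Prop) : ℝ≥0∞ := if p then 1 else 0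

lemma toOuterMeasure_eq_tsum {α : Type*} (p : PMF α) (s : Set α) :
    p.toOuterMeasure s = ∑' a, p a * propIndicator (a ∈ s) := by
  rw [p.toOuterMeasure_apply]
  exact tsum_congr fun a => by by_cases h : a ∈ s <;> simp [h, propIndicator]

lemma toOuterMeasure_bind_map {α β : Type*} (p : PMF α) (q : PMF β) (s : Set (α × β)) :
    (p.bind fun a => q.map fun b => (a, b)).toOuterMeasure s =
      ∑' a, ∑' b, p a * (q b * propIndicator ((a, b) ∈ s)) := by
  rw [PMF.toOuterMeasure_bind_apply]
  refine tsum_congr fun a => ?_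
  rw [PMF.toOuterMeasure_map_apply, toOuterMeasure_eq_tsum, ENNReal.tsum_mul_left]
  rfl

/-- Each pair of coins is consistent with exactly one transcript, so the sum over `m` collapses to
`run a b`. Taking `W` true gives total mass `1`; taking `W` to be a wrong answer gives the error
probability. -/
lemma sum_toOuterMeasure_mul {RA RB M : Type*} [Fintype M] (pA : PMF RA) (pB : PMF RB)
    (run : RA → RB → M) {cA : RA → M → Prop} {cB : RB → M → Prop}
    (h : ∀ a b m, run a b = m ↔ cA a m ∧ cB b m) (W : M → RB → Prop) :
    ∑ m, pA.toOuterMeasure {a | cA a m} * pB.toOuterMeasure {b | cB b m ∧ W m b} =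
      ∑' a, ∑' b, pA a * (pB b * propIndicator (W (run a b) b)) := by
  simp_rw [toOuterMeasure_eq_tsum, ← ENNReal.tsum_mul_right, ← ENNReal.tsum_mul_left]
  rw [← Summable.tsum_finsetSum fun _ _ => ENNReal.summable]
  refine tsum_congr fun a => ?_
  rw [← Summable.tsum_finsetSum fun _ _ => ENNReal.summable]
  refine tsum_congr fun b => ?_
  rw [Finset.sum_eq_single (run a b)]
  · obtain ⟨h1, h2⟩ := (h a b _).1 rfl
    have h3 : (cB b (run a b) ∧ W (run a b) b) = W (run a b) b := propext (and_iff_right h2)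
    rw [Set.mem_ofPred_eq, Set.mem_ofPred_eq, h3, propIndicator, if_pos h1, mul_one]
  · intro m _ hm
    have h1 : ¬ (cA a m ∧ cB b m) := fun h' => hm ((h a b m).2 h').symm
    by_cases h2 : cA a m
    · have h3 : ¬ cB b m := fun h3 => h1 ⟨h2, h3⟩
      simp [h3, propIndicator]
    · simp [h2, propIndicator]
  · simp

/-- The model of a protocol in which the second party answers. -/
noncomputable def modelOf {X Y Z RA RB M : Type*} [Fintype M] [MeasurableSpace Z]
    (pA : PMF RA) (pB : PMF RB) (run : X × RA → Y × RB → M) (cA : X × RA → M → Prop)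
    (cB : Y × RB → M → Prop) (h : ∀ a b m, run a b = m ↔ cA a m ∧ cB b m)
    (out : M → Y × RB → Z) : TranscriptModel X Y M Z where
  α x m := (pA.toOuterMeasure {a | cA (x, a) m}).toReal
  -- The answer may depend on Bob's coins, which are correlated with the transcript; hence the law
  -- of the answer is restricted to the coins consistent with `m`.
  ν y m := letI : MeasurableSpace RB := ⊤
    (pB.toMeasure.restrict {b | cB (y, b) m}).map fun b => out m (y, b)
  finite y m := by infer_instance
  α_nonneg x m := ENNReal.toReal_nonneg
  sum_eq_one x y := by
    let : MeasurableSpace RB := ⊤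
    have h1 : ∀ m, ((pB.toMeasure.restrict {b | cB (y, b) m}).map fun b => out m (y, b)).real
        Set.univ = (pB.toOuterMeasure {b | cB (y, b) m ∧ True}).toReal := fun m => by
      rw [MeasureTheory.measureReal_def, MeasureTheory.Measure.map_apply .of_discrete .univ,
        Set.preimage_univ, MeasureTheory.Measure.restrict_apply_univ,
        PMF.toMeasure_apply_eq_toOuterMeasure]
      simp
    simp_rw [h1, ← ENNReal.toReal_mul]
    rw [← ENNReal.toReal_sum fun m _ =>
      ENNReal.mul_ne_top (toOuterMeasure_ne_top _ _) (toOuterMeasure_ne_top _ _),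
      sum_toOuterMeasure_mul pA pB (fun a b => run (x, a) (y, b)) (fun a b m => h _ _ m)
        fun _ _ => True]
    simp [propIndicator, ENNReal.tsum_mul_left, PMF.tsum_coe]

section modelOf

variable {X Y Z RA RB M : Type*} [Fintype M] [MeasurableSpace Z] [DiscreteMeasurableSpace Z]
    {pA : PMF RA} {pB : PMF RB} {run : X × RA → Y × RB → M} {cA : X × RA → M → Prop}
    {cB : Y × RB → M → Prop} (h : ∀ a b m, run a b = m ↔ cA a m ∧ cB b m)
    (out : M → Y × RB → Z)

lemma modelOf_ν_real (y : Y) (m : M) (S : Set Z) :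
    ((modelOf pA pB run cA cB h out).ν y m).real S =
      (pB.toOuterMeasure {b | cB (y, b) m ∧ out m (y, b) ∈ S}).toReal := by
  let : MeasurableSpace RB := ⊤
  change ((pB.toMeasure.restrict {b | cB (y, b) m}).map fun b => out m (y, b)).real S = _
  rw [MeasureTheory.measureReal_def, MeasureTheory.Measure.map_apply .of_discrete .of_discrete,
    MeasureTheory.Measure.restrict_apply .of_discrete, PMF.toMeasure_apply_eq_toOuterMeasure]
  congr 2
  ext b
  exact And.comm

lemma modelOf_α (x : X) (m : M) : (modelOf pA pB run cA cB h out).α x m =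
    (pA.toOuterMeasure {a | cA (x, a) m}).toReal := rfl

lemma modelOf_β (y : Y) (m : M) : (modelOf pA pB run cA cB h out).β y m =
    (pB.toOuterMeasure {b | cB (y, b) m}).toReal := by
  rw [TranscriptModel.β, modelOf_ν_real]
  simp

lemma modelOf_computes (f : X → Y → Z → Prop) {ε : ℝ} (hε : 0 ≤ ε)
    (hf : ∀ x y, ∑' a, ∑' b, pA a * (pB b *
      propIndicator (¬ f x y (out (run (x, a) (y, b)) (y, b)))) ≤ ENNReal.ofReal ε) :
    (modelOf pA pB run cA cB h out).Computes f ε := by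
  intro x y
  simp_rw [modelOf_ν_real, modelOf_α, ← ENNReal.toReal_mul]
  rw [← ENNReal.toReal_sum fun m _ =>
      ENNReal.mul_ne_top (toOuterMeasure_ne_top _ _) (toOuterMeasure_ne_top _ _)]
  refine ENNReal.toReal_le_of_le_ofReal hε ?_
  refine le_trans (le_of_eq ?_) (hf x y)
  exact sum_toOuterMeasure_mul pA pB (fun a b => run (x, a) (y, b)) (fun a b m => h _ _ m)
    fun m b => ¬ f x y (out m (y, b))

end modelOf

/-! ### Mutual information as relative entropy -/

lemma toReal_map_fst {α β : Type*} [Fintype α] [Fintype β] (p : PMF (α × β)) (a : α) :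
    ((p.map Prod.fst) a).toReal = ∑ b, (p (a, b)).toReal := by
  classical
  rw [PMF.map_apply, tsum_fintype, Fintype.sum_prod_type, ← ENNReal.toReal_sum fun b _ =>
    p.apply_ne_top _]
  congr 1
  rw [Finset.sum_eq_single a]
  · simp
  · intro a' _ h
    simp [h.symm]
  · simp

lemma toReal_map_snd {α β : Type*} [Fintype α] [Fintype β] (p : PMF (α × β)) (b : β) :
    ((p.map Prod.snd) b).toReal = ∑ a, (p (a, b)).toReal := by
  classical
  rw [PMF.map_apply, tsum_fintype, Fintype.sum_prod_type, ← ENNReal.toReal_sum fun b _ =>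
    p.apply_ne_top _]
  congr 1
  refine Finset.sum_congr rfl fun a _ => ?_
  rw [Finset.sum_eq_single b]
  · simp
  · intro b' _ h
    simp [h.symm]
  · simp

lemma mutualInfo_mul_log_two {α β : Type*} [Fintype α] [Fintype β] (p : PMF (α × β))
    {u : α → ℝ} {q : α → β → ℝ} {r : β → ℝ} (hp : ∀ a b, (p (a, b)).toReal = u a * q a b)
    (hq : ∀ a, ∑ b, q a b = 1) (hr : ∀ b, ∑ a, u a * q a b = r b) :
    mutualInfo p * Real.log 2 =
      relEntropy (fun i : α × β => u i.1 * q i.1 i.2) (fun i => u i.1 * r i.2) := by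
  have h1 : ∀ a, ((p.map Prod.fst) a).toReal = u a := fun a => by
    simp_rw [toReal_map_fst, hp, ← Finset.mul_sum, hq, mul_one]
  have h2 : ∀ b, ((p.map Prod.snd) b).toReal = r b := fun b => by
    simp_rw [toReal_map_snd, hp, hr]
  have h0 : ∀ a b, 0 ≤ u a * q a b := fun a b => by
    rw [← hp]
    exact ENNReal.toReal_nonneg
  have hlog2 : Real.log 2 ≠ 0 := (Real.log_pos one_lt_two).ne'
  rw [mutualInfo, entropy, entropy, entropy, sub_mul, add_mul, div_mul_cancel₀ _ hlog2,
    div_mul_cancel₀ _ hlog2, div_mul_cancel₀ _ hlog2, relEntropy, Fintype.sum_prod_type,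
    Fintype.sum_prod_type]
  simp_rw [h1, h2, hp, Real.negMulLog]
  have h3 : ∑ a, -u a * Real.log (u a) = ∑ a, ∑ b, -(u a * q a b) * Real.log (u a) :=
    Finset.sum_congr rfl fun a _ => by
      rw [← Finset.sum_mul, Finset.sum_neg_distrib, ← Finset.mul_sum, hq, mul_one]
  have h4 : ∑ b, -r b * Real.log (r b) = ∑ a, ∑ b, -(u a * q a b) * Real.log (r b) := by
    rw [Finset.sum_comm]
    refine Finset.sum_congr rfl fun b _ => ?_
    rw [← Finset.sum_mul, Finset.sum_neg_distrib, hr]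
  rw [h3, h4, ← Finset.sum_add_distrib, ← Finset.sum_sub_distrib]
  refine Finset.sum_congr rfl fun a _ => ?_
  rw [← Finset.sum_add_distrib, ← Finset.sum_sub_distrib]
  refine Finset.sum_congr rfl fun b _ => ?_
  -- Null terms vanish on both sides; a nonzero term forces `u a` and `r b` to be nonzero, so the
  -- logarithms split.
  by_cases h : u a * q a b = 0
  · simp [h]
  have hu : u a ≠ 0 := left_ne_zero_of_mul h
  have hrb : r b ≠ 0 := by
    intro h'
    rw [← hr b] at h'
    exact h ((Finset.sum_eq_zero_iff_of_nonneg fun a _ => h0 a b).1 h' a (Finset.mem_univ a))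
  rw [Real.log_div h (mul_ne_zero hu hrb), Real.log_mul hu hrb]
  ring

namespace TranscriptModel

variable {X Y M Z : Type*} [Fintype X] [Fintype Y] [Fintype M] [MeasurableSpace Z]
  (T : TranscriptModel X Y M Z) {mx : X → ℝ} {my : Y → ℝ}

lemma infoX_eq_mutualInfo (p : PMF (X × M)) (hmy1 : ∑ y, my y = 1)
    (hp : ∀ x m, (p (x, m)).toReal = mx x * T.lawX my x m) :
    T.infoX mx my = mutualInfo p * Real.log 2 :=
  (mutualInfo_mul_log_two p hp (T.sum_lawX hmy1) T.sum_mul_lawX).symm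

lemma infoY_eq_mutualInfo (p : PMF (Y × M)) (hmx1 : ∑ x, mx x = 1)
    (hp : ∀ y m, (p (y, m)).toReal = my y * T.lawY mx y m) :
    T.infoY mx my = mutualInfo p * Real.log 2 :=
  (mutualInfo_mul_log_two p hp (T.sum_lawY hmx1) T.sum_mul_lawY).symm

end TranscriptModel

/-! ### The laws of a protocol -/

namespace Protocol

variable {X Y Z RA RB : Type*} (P : Protocol X Y RA RB)

lemma transcriptLaw_toReal (x : X) (y : Y) (m : P.tree.Transcript) :
    (P.transcriptLaw x y m).toReal =
      (P.coinsA.toOuterMeasure {a | P.tree.AliceConsistent (x, a) m}).toReal *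
        (P.coinsB.toOuterMeasure {b | P.tree.BobConsistent (y, b) m}).toReal := by
  classical
  rw [← ENNReal.toReal_mul, ← PMF.toOuterMeasure_apply_singleton, transcriptLaw,
    PMF.toOuterMeasure_map_apply, coins, toOuterMeasure_bind_map, toOuterMeasure_eq_tsum,
    toOuterMeasure_eq_tsum]
  simp_rw [← ENNReal.tsum_mul_right, ← ENNReal.tsum_mul_left]
  congr 1
  refine tsum_congr fun a => tsum_congr fun b => ?_
  have h := P.tree.run_eq_iff (x, a) (y, b) m
  by_cases h1 : P.tree.AliceConsistent (x, a) m <;>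
  by_cases h2 : P.tree.BobConsistent (y, b) m <;> simp [h1, h2, h, propIndicator]

variable [Fintype X] [Fintype Y]

lemma lawXM_toReal (μX : PMF X) (μY : PMF Y) (x : X) (m : P.tree.Transcript) :
    (P.lawXM μX μY (x, m)).toReal =
      (μX x).toReal * ∑ y, (μY y).toReal * (P.transcriptLaw x y m).toReal := by
  classical
  rw [lawXM, PMF.bind_apply, tsum_fintype, Finset.sum_eq_single x]
  · rw [PMF.bind_apply, tsum_fintype, ENNReal.toReal_mul, ENNReal.toReal_sum fun y _ =>
      ENNReal.mul_ne_top (μY.apply_ne_top _) (PMF.apply_ne_top _ _)]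
    simp
  · intro x' _ hx
    simp [PMF.bind_apply, hx.symm]
  · simp

lemma lawYM_toReal (μX : PMF X) (μY : PMF Y) (y : Y) (m : P.tree.Transcript) :
    (P.lawYM μX μY (y, m)).toReal =
      (μY y).toReal * ∑ x, (μX x).toReal * (P.transcriptLaw x y m).toReal := by
  classical
  have h : ∀ x, (μY.bind fun y' => (P.transcriptLaw x y').map fun m => (y', m)) (y, m) =
      μY y * P.transcriptLaw x y m := by
    intro x
    rw [PMF.bind_apply, tsum_fintype, Finset.sum_eq_single y]
    · simp
    · intro y' _ hy
      simp [hy.symm]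
    · simp
  rw [lawYM, PMF.bind_apply, tsum_fintype]
  simp_rw [h]
  rw [ENNReal.toReal_sum fun x _ => ENNReal.mul_ne_top (μX.apply_ne_top _)
    (ENNReal.mul_ne_top (μY.apply_ne_top _) (PMF.apply_ne_top _ _)), Finset.mul_sum]
  refine Finset.sum_congr rfl fun x _ => ?_
  rw [ENNReal.toReal_mul, ENNReal.toReal_mul]
  ring

end Protocol

/-! ### The tradeoff -/

lemma hasOneWayProtocol_of_sum_le {X Y Z : Type*} [Fintype X] [Fintype Y] {f : X → Y → Z → Prop}
    {ε : ℝ} {μX : PMF X} {μY : PMF Y} {c : ℕ} (msg : X → (Fin c → Bool))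
    (out : (Fin c → Bool) → Y → Z)
    (h : ∑ x, (μX x).toReal * ∑ y, (μY y).toReal * loss f x y (out (msg x) y) ≤ ε) :
    HasOneWayProtocol f ε (prodLaw μX μY) c := by
  classical
  refine ⟨msg, out, ?_⟩
  rw [prodLaw, toOuterMeasure_bind_map]
  simp_rw [tsum_fintype]
  have h1 : ∀ x y, μX x * (μY y * propIndicator ((x, y) ∈
      {p : X × Y | ¬ f p.1 p.2 (out (msg p.1) p.2)})) ≠ ⊤ := fun x y => ENNReal.mul_ne_top (PMF.apply_ne_top _ _)
    (ENNReal.mul_ne_top (PMF.apply_ne_top _ _) (by rw [propIndicator]; split_ifs <;> simp))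
  refine (ENNReal.le_ofReal_iff_toReal_le (ENNReal.sum_ne_top.2 fun x _ =>
    ENNReal.sum_ne_top.2 fun y _ => h1 x y) ?_).2 (le_trans (le_of_eq ?_) h)
  · exact le_trans (Finset.sum_nonneg fun x _ => mul_nonneg ENNReal.toReal_nonneg
      (Finset.sum_nonneg fun y _ => mul_nonneg ENNReal.toReal_nonneg (loss_nonneg _ _ _ _))) h
  · rw [ENNReal.toReal_sum fun x _ => ENNReal.sum_ne_top.2 fun y _ => h1 x y]
    refine Finset.sum_congr rfl fun x _ => ?_
    rw [ENNReal.toReal_sum fun y _ => h1 x y, Finset.mul_sum]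
    refine Finset.sum_congr rfl fun y _ => ?_
    rw [ENNReal.toReal_mul, ENNReal.toReal_mul, loss]
    by_cases hf : f x y (out (msg x) y) <;> simp [hf, propIndicator]

theorem exists_oneWayProductAB_le {ε ε' : ℝ} (hε : 0 < ε) (hεε' : ε ≤ ε') (hε' : ε' < 1 / 2) :
    ∃ C : ℝ, 0 < C ∧ ∀ (X : Type uX) (Y : Type uY) (M : Type) (Z : Type uZ)
      [Fintype X] [Fintype Y] [Fintype M] [MeasurableSpace Z] [DiscreteMeasurableSpace Z]
      (T : TranscriptModel X Y M Z) (f : X → Y → Z → Prop) (LA LB : ℝ),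
      (ε < ε' ∨ SingleValued f) → T.Computes f ε → (X → Y → Nonempty Z) →
      (∀ (μX : PMF X) (μY : PMF Y), T.infoX (fun x => (μX x).toReal) (fun y => (μY y).toReal) ≤
        LA * Real.log 2) →
      (∀ (μX : PMF X) (μY : PMF Y), T.infoY (fun x => (μX x).toReal) (fun y => (μY y).toReal) ≤
        LB * Real.log 2) →
      (oneWayProductAB f ε' : ENNReal) ≤ ENNReal.ofReal (LA * (2 : ℝ) ^ (C * (LB + 1))) := by
  obtain ⟨C, hC, hmain⟩ := TranscriptModel.exists_oneWay.{uX, uY, uZ} hε hεε' hε'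
  have hlog2 : 0 < Real.log 2 := Real.log_pos one_lt_two
  have hlog2' : Real.log 2 ≤ 1 := by
    have := Real.log_two_lt_d9
    linarith
  refine ⟨C / Real.log 2, by positivity, ?_⟩
  intro X Y M Z _ _ _ _ _ T f LA LB hf hT hZ hLA hLB
  set v := LA * (2 : ℝ) ^ (C / Real.log 2 * (LB + 1)) with hv
  suffices h : oneWayProductAB f ε' ≤ (⌊v⌋₊ : ℕ∞) by
    -- The sign of `LA` is known only once input distributions exist. If `v` is negative, its
    -- natural floor is `0`, and so is the complexity.
    rcases lt_or_ge v 0 with hneg | hpos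
    · rw [Nat.floor_of_nonpos hneg.le] at h
      have h0 : oneWayProductAB f ε' = 0 := by simpa using h
      rw [h0]
      simp
    refine (ENat.toENNReal_mono h).trans ?_
    rw [ENat.toENNReal_coe, ← ENNReal.ofReal_natCast]
    exact ENNReal.ofReal_le_ofReal (Nat.floor_le hpos)
  refine iSup₂_le fun μX μY => ?_
  obtain ⟨x₀, -⟩ := μX.support_nonempty
  obtain ⟨y₀, -⟩ := μY.support_nonempty
  have := hZ x₀ y₀
  have hA := hLA μX μY
  have hB := hLB μX μY
  have hA0 := (T.infoX_nonneg (fun x => ENNReal.toReal_nonneg) (fun y => ENNReal.toReal_nonneg)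
    (pmf_sum_toReal μX) (pmf_sum_toReal μY)).trans hA
  have hB0 := (T.infoY_nonneg (fun x => ENNReal.toReal_nonneg) (fun y => ENNReal.toReal_nonneg)
    (pmf_sum_toReal μX) (pmf_sum_toReal μY)).trans hB
  have hLA0 : 0 ≤ LA := nonneg_of_mul_nonneg_left hA0 hlog2
  have hLB0 : 0 ≤ LB := nonneg_of_mul_nonneg_left hB0 hlog2
  obtain ⟨c, hc, msg, out, herr⟩ := hmain X Y M Z T f _ _ _ _ hf hT
    (fun x => ENNReal.toReal_nonneg) (fun y => ENNReal.toReal_nonneg)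
    (pmf_sum_toReal μX) (pmf_sum_toReal μY) hA hB
  have hcv : (c : ℝ) ≤ v := by
    refine hc.trans ?_
    rw [hv, Real.rpow_def_of_pos two_pos]
    -- Conversion from base `e` to base `2`; the factors `log 2` between nats and bits in `LA` and
    -- `LB` are dropped using `log 2 ≤ 1`.
    have h1 : Real.log 2 * (C / Real.log 2 * (LB + 1)) = C * (LB + 1) := by field_simp
    rw [h1]
    refine mul_le_mul (mul_le_of_le_one_right hLA0 hlog2') (Real.exp_le_exp.2 ?_)
      (Real.exp_pos _).le hLA0
    have := mul_le_of_le_one_right hLB0 hlog2'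
    nlinarith
  refine (iInf₂_le c (hasOneWayProtocol_of_sum_le msg out herr)).trans ?_
  exact_mod_cast Nat.le_floor hcv

namespace Protocol

variable {X : Type uX} {Y : Type uY} [Fintype X] [Fintype Y] {Z RA RB : Type*}
  (P : Protocol X Y RA RB)

lemma mutualInfo_lawXM_le (μX : PMF X) (μY : PMF Y) :
    mutualInfo (P.lawXM μX μY) ≤ P.privacyLossAB :=
  le_ciSup (bddAbove_privacyLossAB P) (μX, μY)

lemma mutualInfo_lawYM_le (μX : PMF X) (μY : PMF Y) :
    mutualInfo (P.lawYM μX μY) ≤ P.privacyLossBA :=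
  le_ciSup (bddAbove_privacyLossBA P) (μX, μY)

/-- The factorization of the transcript law when Bob answers. -/
noncomputable def bobModel [MeasurableSpace Z] (out : P.tree.Transcript → Y × RB → Z) :
    TranscriptModel X Y P.tree.Transcript Z :=
  modelOf P.coinsA P.coinsB P.tree.run P.tree.AliceConsistent P.tree.BobConsistent
    P.tree.run_eq_iff out

/-- The factorization of the transcript law when Alice answers. -/
noncomputable def aliceModel [MeasurableSpace Z] (out : P.tree.Transcript → X × RA → Z) :
    TranscriptModel Y X P.tree.Transcript Z :=
  modelOf P.coinsB P.coinsA (fun b a => P.tree.run a b) P.tree.BobConsistent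
    P.tree.AliceConsistent (fun b a m => (P.tree.run_eq_iff a b m).trans And.comm) out

variable [MeasurableSpace Z] [DiscreteMeasurableSpace Z]

lemma infoX_bobModel (out : P.tree.Transcript → Y × RB → Z) (μX : PMF X) (μY : PMF Y) :
    (P.bobModel out).infoX (fun x => (μX x).toReal) (fun y => (μY y).toReal) =
      mutualInfo (P.lawXM μX μY) * Real.log 2 := by
  refine (P.bobModel out).infoX_eq_mutualInfo _ (pmf_sum_toReal μY) fun x m => ?_
  rw [lawXM_toReal, TranscriptModel.lawX_eq_sum]
  congr 1
  refine Finset.sum_congr rfl fun y _ => ?_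
  rw [transcriptLaw_toReal, bobModel, modelOf_α, modelOf_β]

lemma infoY_bobModel (out : P.tree.Transcript → Y × RB → Z) (μX : PMF X) (μY : PMF Y) :
    (P.bobModel out).infoY (fun x => (μX x).toReal) (fun y => (μY y).toReal) =
      mutualInfo (P.lawYM μX μY) * Real.log 2 := by
  refine (P.bobModel out).infoY_eq_mutualInfo _ (pmf_sum_toReal μX) fun y m => ?_
  rw [lawYM_toReal, TranscriptModel.lawY_eq_sum]
  congr 1
  refine Finset.sum_congr rfl fun x _ => ?_
  rw [transcriptLaw_toReal, bobModel, modelOf_α, modelOf_β]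

lemma infoX_aliceModel (out : P.tree.Transcript → X × RA → Z) (μX : PMF X) (μY : PMF Y) :
    (P.aliceModel out).infoX (fun y => (μY y).toReal) (fun x => (μX x).toReal) =
      mutualInfo (P.lawYM μX μY) * Real.log 2 := by
  refine (P.aliceModel out).infoX_eq_mutualInfo _ (pmf_sum_toReal μX) fun y m => ?_
  rw [lawYM_toReal, TranscriptModel.lawX_eq_sum]
  congr 1
  refine Finset.sum_congr rfl fun x _ => ?_
  rw [transcriptLaw_toReal, aliceModel, modelOf_α, modelOf_β,
    mul_comm (ENNReal.toReal (PMF.toOuterMeasure P.coinsB _))]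

lemma infoY_aliceModel (out : P.tree.Transcript → X × RA → Z) (μX : PMF X) (μY : PMF Y) :
    (P.aliceModel out).infoY (fun y => (μY y).toReal) (fun x => (μX x).toReal) =
      mutualInfo (P.lawXM μX μY) * Real.log 2 := by
  refine (P.aliceModel out).infoY_eq_mutualInfo _ (pmf_sum_toReal μY) fun x m => ?_
  rw [lawXM_toReal, TranscriptModel.lawY_eq_sum]
  congr 1
  refine Finset.sum_congr rfl fun y _ => ?_
  rw [transcriptLaw_toReal, aliceModel, modelOf_α, modelOf_β,
    mul_comm (ENNReal.toReal (PMF.toOuterMeasure P.coinsB _))]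

lemma privacyLossAB_nonneg : 0 ≤ P.privacyLossAB := by
  refine Real.iSup_nonneg fun μ => nonneg_of_mul_nonneg_left ?_ (Real.log_pos one_lt_two)
  -- The information does not depend on the answering rule, so a dummy rule with values in `Unit`
  -- serves.
  rw [← P.infoX_bobModel fun _ _ => ()]
  exact TranscriptModel.infoX_nonneg _ (fun _ => ENNReal.toReal_nonneg)
    (fun _ => ENNReal.toReal_nonneg) (pmf_sum_toReal _) (pmf_sum_toReal _)

lemma privacyLossBA_nonneg : 0 ≤ P.privacyLossBA := by
  refine Real.iSup_nonneg fun μ => nonneg_of_mul_nonneg_left ?_ (Real.log_pos one_lt_two)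
  rw [← P.infoY_bobModel fun _ _ => ()]
  exact TranscriptModel.infoY_nonneg _ (fun _ => ENNReal.toReal_nonneg)
    (fun _ => ENNReal.toReal_nonneg) (pmf_sum_toReal _) (pmf_sum_toReal _)

lemma BobComputes.bobModel {out : P.tree.Transcript → Y × RB → Z} {f : X → Y → Z → Prop} {ε : ℝ}
    (hε : 0 ≤ ε) (h : P.BobComputes out f ε) : (P.bobModel out).Computes f ε := by
  refine modelOf_computes _ _ f hε fun x y => le_trans (le_of_eq ?_) (h x y)
  rw [coins, toOuterMeasure_bind_map]
  rfl

lemma AliceComputes.aliceModel {out : P.tree.Transcript → X × RA → Z} {f : X → Y → Z → Prop}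
    {ε : ℝ} (hε : 0 ≤ ε) (h : P.AliceComputes out f ε) :
    (P.aliceModel out).Computes (fun y x z => f x y z) ε := by
  refine modelOf_computes _ _ _ hε fun y x => le_trans (le_of_eq ?_) (h x y)
  rw [coins, toOuterMeasure_bind_map, ENNReal.tsum_comm]
  refine tsum_congr fun a => tsum_congr fun b => ?_
  rw [mul_left_comm]
  rfl

end Protocol

end PrivacyTradeoff

theorem mainTheorem8 (ε ε' : ℝ) (hε : 0 < ε) (hεε' : ε ≤ ε') (hε' : ε' < 1 / 2) :
    ∃ C : ℝ, 0 < C ∧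
      ∀ (X Y Z RA RB : Type*) [Fintype X] [Fintype Y] (f : X → Y → Z → Prop),
        (ε < ε' ∨ PrivacyTradeoff.SingleValued f) →
        ∀ P : PrivacyTradeoff.Protocol X Y RA RB,
          ((∃ out : P.tree.Transcript → Y × RB → Z, P.BobComputes out f ε) →
            (PrivacyTradeoff.oneWayProductAB f ε' : ENNReal) ≤
              ENNReal.ofReal (P.privacyLossAB * (2 : ℝ) ^ (C * (P.privacyLossBA + 1)))) ∧
          ((∃ out : P.tree.Transcript → X × RA → Z, P.AliceComputes out f ε) →
            (PrivacyTradeoff.oneWayProductBA f ε' : ENNReal) ≤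
              ENNReal.ofReal (P.privacyLossBA * (2 : ℝ) ^ (C * (P.privacyLossAB + 1)))) := by
  obtain ⟨C₁, hC₁, h₁⟩ := PrivacyTradeoff.exists_oneWayProductAB_le hε hεε' hε'
  -- A second instance is needed because the universes of `X` and `Y` are exchanged when Alice
  -- answers; the two constants are merged by `max`.
  obtain ⟨C₂, hC₂, h₂⟩ := PrivacyTradeoff.exists_oneWayProductAB_le hε hεε' hε'
  refine ⟨max C₁ C₂, lt_max_of_lt_left hC₁, ?_⟩
  intro X Y Z RA RB _ _ f hf P
  let : MeasurableSpace Z := ⊤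
  have hlog2 : 0 ≤ Real.log 2 := Real.log_nonneg one_le_two
  have hmono : ∀ {L L' D : ℝ}, 0 ≤ L → 0 ≤ L' → D ≤ max C₁ C₂ →
      ENNReal.ofReal (L * (2 : ℝ) ^ (D * (L' + 1))) ≤
        ENNReal.ofReal (L * (2 : ℝ) ^ (max C₁ C₂ * (L' + 1))) := fun hL hL' hD =>
    ENNReal.ofReal_le_ofReal (mul_le_mul_of_nonneg_left (Real.rpow_le_rpow_of_exponent_le
      one_le_two (mul_le_mul_of_nonneg_right hD (by positivity))) hL)
  have hA := P.privacyLossAB_nonneg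
  have hB := P.privacyLossBA_nonneg
  -- Fixed coins, used only to produce an answer from any input pair and thus show that `Z` is
  -- nonempty.
  obtain ⟨a₀, -⟩ := P.coinsA.support_nonempty
  obtain ⟨b₀, -⟩ := P.coinsB.support_nonempty
  constructor
  · rintro ⟨out, hout⟩
    refine (h₁ X Y P.tree.Transcript Z (P.bobModel out) f P.privacyLossAB P.privacyLossBA hf
      (hout.bobModel P hε.le) (fun x y => ⟨out (P.tree.run (x, a₀) (y, b₀)) (y, b₀)⟩)
      (fun μX μY => ?_) (fun μX μY => ?_)).trans (hmono hA hB (le_max_left _ _))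
    · rw [P.infoX_bobModel]
      exact mul_le_mul_of_nonneg_right (P.mutualInfo_lawXM_le μX μY) hlog2
    · rw [P.infoY_bobModel]
      exact mul_le_mul_of_nonneg_right (P.mutualInfo_lawYM_le μX μY) hlog2
  · rintro ⟨out, hout⟩
    refine (h₂ Y X P.tree.Transcript Z (P.aliceModel out) (fun y x z => f x y z) P.privacyLossBA
      P.privacyLossAB (hf.imp_right fun h y x => h x y)
      (hout.aliceModel P hε.le) (fun y x => ⟨out (P.tree.run (x, a₀) (y, b₀)) (x, a₀)⟩)
      (fun μY μX => ?_) (fun μY μX => ?_)).trans (hmono hB hA (le_max_right _ _))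
    · rw [P.infoX_aliceModel]
      exact mul_le_mul_of_nonneg_right (P.mutualInfo_lawYM_le μX μY) hlog2
    · rw [P.infoY_aliceModel]
      exact mul_le_mul_of_nonneg_right (P.mutualInfo_lawXM_le μX μY) hlog2
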